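/- Let $n\ge 1$, let $\Theta\subseteq\mathbb{R}^n$ be open, and let $\theta$ be a random vector with a probability density $p_\theta$ that is positive on $\Theta$ and satisfies $\int_\Theta p_\theta(\theta)\,d\theta=1$. Assume that $1/p_\theta$ is locally integrable on $\Theta$; equivalently, every function that is square integrable on $\Theta$ with respect to $p_\theta(\theta)\,d\theta$ is locally integrable on $\Theta$, and so has a distributional derivative (this holds, for instance, when $p_\theta$ is locally bounded away from $0$ on $\Theta$). Let $x$ be a measurement with conditional density $p(x\mid\theta)$, $\theta\in\Theta$, with respect to a $\sigma$-finite measure $dx$, and assume the following regularity conditions. 1. For every $x$, $p(x\mid\theta)$ is continuously differentiable in $\theta\in\Theta$. 2. The Fisher information matrix $J(\theta)_{ij}=E\big[\frac{\partial\log p(x\mid\theta)}{\partial\theta_i}\frac{\partial\log p(x\mid\theta)}{\partial\theta_j}\,;\theta\big]$ exists, is positive definite for every $\theta\in\Theta$, and is bounded on $\Theta$; moreover $\int_\Theta \mathrm{Tr}(J(\theta)^{-1})\,p_\theta(\theta)\,d\theta<\infty$ or $\int_\Theta\|\theta\|^2p_\theta(\theta)\,d\theta<\infty$ (at least one of the two).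 3. For every $\theta\in\Theta$ and every $i$, $\partial p(x\mid\theta)/\partial\theta_i$ is integrable in $x$ and $\int\frac{\partial}{\partial\theta_i}p(x\mid\theta)\,dx=\frac{\partial}{\partial\theta_i}\int p(x\mid\theta)\,dx$. An estimator is a measurable $\mathbb{R}^n$-valued function $\hat\theta(x)$ for which there is an integrable function $g$ such that, for almost every $x$, $\big\|\frac{\partial p(x\mid\theta)}{\partial\theta}\,\hat\theta(x)^T\big\|_F\le g(x)$ for all $\theta\in\Theta$. Let $H^1$ be the set of functions $b:\Theta\to\mathbb{R}^n$ with $\int_\Theta\|b\|^2p_\theta\,d\theta<\infty$ whose distributional derivative $\frac{\partial b}{\partial\theta}=\big(\frac{\partial b_i}{\partial\theta_j}\big)_{ij}$ is a function with $\int_\Theta\big\|\frac{\partial b}{\partial\theta}\big\|_F^2\,p_\theta\,d\theta<\infty$, and put $$\mathrm{CRB}[b,\theta]=\mathrm{Tr}\Big(\big(I+\tfrac{\partial b}{\partial\theta}\big)J(\theta)^{-1}\big(I+\tfrac{\partial b}{\partial\theta}\big)^T\Big)+\|b(\theta)\|^2,\qquad Z[b]=\int_\Theta\mathrm{CRB}[b,\theta]\,p_\theta(\theta)\,d\theta\in[0,\infty].$$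 Then $Z$ attains its minimum over $H^1$; the minimum is finite and nonzero; the minimizing function $\bar b\in H^1$ is unique up to sets of probability zero; and every estimator $\hat\theta$ satisfies $$E\{\|\theta-\hat\theta\|^2\}=\int_\Theta\int\|\hat\theta(x)-\theta\|^2\,p(x\mid\theta)\,dx\;p_\theta(\theta)\,d\theta\;\ge\;\min_{b\in H^1}Z[b].$$ -/

import Mathlib

open MeasureTheory
open scoped ENNReal ContDiff

noncomputable section

namespace OBB

/-- The parameter space `ℝⁿ` with its Euclidean norm. -/
abbrev Param (n : ℕ) : Type := EuclideanSpace ℝ (Fin n)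

/-- The partial derivative `∂f/∂θ_i` at `θ`. -/
def partialD {n : ℕ} (f : Param n → ℝ) (i : Fin n) (θ : Param n) : ℝ :=
  fderiv ℝ f θ (EuclideanSpace.single i 1)

/-! ### The prior -/

/-- `q` is (a version of) a probability density that is positive on the open set `Θ` and carries
all of its mass there.  Values of `q` outside `Θ` are irrelevant. -/
structure IsPrior {n : ℕ} (Θ : Set (Param n)) (q : Param n → ℝ) : Prop where
  isOpen : IsOpen Θ
  measurable : Measurable q
  pos : ∀ θ ∈ Θ, 0 < q θ
  mass : ∫⁻ θ in Θ, ENNReal.ofReal (q θ) = 1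

/-- The prior distribution `q(θ) dθ` on `Θ`. -/
def priorMeasure {n : ℕ} (Θ : Set (Param n)) (q : Param n → ℝ) : Measure (Param n) :=
  (volume.restrict Θ).withDensity (fun θ => ENNReal.ofReal (q θ))

/-! ### The measurement model; `p x θ` is the conditional density of `x` given `θ` -/

/-- The Fisher information matrix `J(θ)_{ij} = E[∂_i log p · ∂_j log p ; θ]`.  The integrand
vanishes where `p x θ = 0`. -/
def fisher {X : Type*} [MeasurableSpace X] {n : ℕ} (μ : Measure X) (p : X → Param n → ℝ)
    (θ : Param n) : Matrix (Fin n) (Fin n) ℝ :=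
  Matrix.of fun i j => ∫ x, partialD (fun ϑ => Real.log (p x ϑ)) i θ *
    partialD (fun ϑ => Real.log (p x ϑ)) j θ * p x θ ∂μ

/-- `p x θ` (`θ ∈ Θ`) is a family of probability densities with respect to `μ` which satisfies the
regularity conditions for the Cramér–Rao bound. -/
structure IsRegularModel {X : Type*} [MeasurableSpace X] {n : ℕ} (μ : Measure X)
    (Θ : Set (Param n)) (p : X → Param n → ℝ) : Prop where
  measurable : ∀ θ ∈ Θ, Measurable fun x => p x θ
  nonneg : ∀ x, ∀ θ ∈ Θ, 0 ≤ p x θ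
  mass : ∀ θ ∈ Θ, ∫⁻ x, ENNReal.ofReal (p x θ) ∂μ = 1
  /-- The density is continuously differentiable in the parameter. -/
  contDiff : ∀ x, ContDiffOn ℝ 1 (p x) Θ
  /-- The expectations defining the Fisher information exist. -/
  fisher_integrable : ∀ θ ∈ Θ, ∀ i j, Integrable (fun x =>
    partialD (fun ϑ => Real.log (p x ϑ)) i θ *
      partialD (fun ϑ => Real.log (p x ϑ)) j θ * p x θ) μ
  /-- The Fisher information is bounded on `Θ`. -/
  fisher_bounded : ∃ K : ℝ, ∀ θ ∈ Θ, ∀ i j, |fisher μ p θ i j| ≤ K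
  /-- The Fisher information is positive definite on `Θ`. -/
  fisher_posDef : ∀ θ ∈ Θ, (fisher μ p θ).PosDef
  /-- Differentiation and integration of the density may be exchanged. -/
  exchange : ∀ θ ∈ Θ, ∀ i, Integrable (fun x => partialD (p x) i θ) μ ∧
    ∫ x, partialD (p x) i θ ∂μ = partialD (fun ϑ => ∫ x, p x ϑ ∂μ) i θ

/-- An estimator: a measurable function of the measurements for which the Frobenius norm of
`(∂p/∂θ) Tᵀ` is dominated, for all `θ ∈ Θ`, by one integrable function. -/
def IsEstimator {X : Type*} [MeasurableSpace X] {n : ℕ} (μ : Measure X)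
    (Θ : Set (Param n)) (p : X → Param n → ℝ) (T : X → Param n) : Prop :=
  Measurable T ∧ ∃ g : X → ℝ, Integrable g μ ∧ ∀ᵐ x ∂μ, ∀ θ ∈ Θ,
    Real.sqrt (∑ i, ∑ j, (partialD (p x) i θ * T x j) ^ 2) ≤ g x

/-- The Bayesian mean-squared error
`∫_Θ (∫ ‖T(x) - θ‖² p(x|θ) dx) q(θ) dθ`, a value in `[0, ∞]`. -/
def bayesMSE {X : Type*} [MeasurableSpace X] {n : ℕ} (μ : Measure X)
    (Θ : Set (Param n)) (q : Param n → ℝ) (p : X → Param n → ℝ) (T : X → Param n) : ℝ≥0∞ :=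
  ∫⁻ θ in Θ, (∫⁻ x, ENNReal.ofReal (‖T x - θ‖ ^ 2) * ENNReal.ofReal (p x θ) ∂μ) *
    ENNReal.ofReal (q θ)

/-! ### The weighted first-order Sobolev space -/

/-- `D` is the distributional derivative of `b` on `Θ`, `D_{ij} = ∂b_i/∂θ_j`: both are locally
integrable functions, and integration by parts holds against all smooth test functions with
compact support in `Θ`. -/
def IsWeakDeriv {n : ℕ} (Θ : Set (Param n)) (b : Param n → Param n)
    (D : Param n → Matrix (Fin n) (Fin n) ℝ) : Prop :=
  (∀ i, LocallyIntegrableOn (fun θ => b θ i) Θ) ∧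
  (∀ i j, LocallyIntegrableOn (fun θ => D θ i j) Θ) ∧
  ∀ φ : Param n → ℝ, ContDiff ℝ ∞ φ → HasCompactSupport φ → tsupport φ ⊆ Θ →
    ∀ i j, ∫ θ in Θ, b θ i * partialD φ j θ = - ∫ θ in Θ, D θ i j * φ θ

open Classical in
/-- The distributional derivative of `b` on `Θ` when it is a function (determined up to a null
set), and `0` otherwise. -/
def weakDeriv {n : ℕ} (Θ : Set (Param n)) (b : Param n → Param n) :
    Param n → Matrix (Fin n) (Fin n) ℝ :=
  if h : ∃ D, IsWeakDeriv Θ b D then h.choose else 0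

/-- The space `H¹`: functions in `L²` of the prior whose distributional derivative is a function
in `L²` of the prior. -/
def H1 {n : ℕ} (Θ : Set (Param n)) (q : Param n → ℝ) : Set (Param n → Param n) :=
  {b | MemLp b 2 (priorMeasure Θ q) ∧ (∃ D, IsWeakDeriv Θ b D) ∧
    ∀ i j, MemLp (fun θ => weakDeriv Θ b θ i j) 2 (priorMeasure Θ q)}

/-! ### The average Cramér–Rao bound -/

/-- `CRB[b, θ] = Tr((I + ∂b/∂θ) J⁻¹ (I + ∂b/∂θ)ᵀ) + ‖b(θ)‖²`, with `b'` the derivative matrix. -/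
def crb {X : Type*} [MeasurableSpace X] {n : ℕ} (μ : Measure X) (p : X → Param n → ℝ)
    (b : Param n → Param n) (b' : Param n → Matrix (Fin n) (Fin n) ℝ) (θ : Param n) : ℝ :=
  Matrix.trace ((1 + b' θ) * (fisher μ p θ)⁻¹ * (1 + b' θ).transpose) + ‖b θ‖ ^ 2

/-- `Z[b] = ∫_Θ CRB[b, θ] q(θ) dθ`, a value in `[0, ∞]`. -/
def avgCRB {X : Type*} [MeasurableSpace X] {n : ℕ} (μ : Measure X)
    (Θ : Set (Param n)) (q : Param n → ℝ) (p : X → Param n → ℝ) (b : Param n → Param n) : ℝ≥0∞ :=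
  ∫⁻ θ in Θ, ENNReal.ofReal (crb μ p b (weakDeriv Θ b) θ) * ENNReal.ofReal (q θ)

end OBB

end

/-!
The average bound `Z` is the squared norm, in an `L²` space of the prior, of an affine function of
the pair `(b, ∂b/∂θ)`, and the theorem is a projection argument in that space.

*Minimum.*  The integrand satisfies the parallelogram identity in `(b, ∂b/∂θ)`
(`two_mul_jetCRB_midpoint_add`).  Since the Fisher information is bounded, `J⁻¹` is bounded below
by a multiple of the identity, so the integrand is uniformly convex in value and derivative
(`IsRegularModel.exists_jetCRB_coercive`).  Minimizing sequences are therefore Cauchy in `L²` of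
the prior, jointly with their derivatives, and Fatou's lemma passes to the limit; uniform convexity
also gives uniqueness (`exists_unique_minimizer`).  The limit is again a function with its
distributional derivative: for a test function `φ`, local integrability of `1 / q` puts `φ / q` in
`L²` of the prior, so integration against `φ` is continuous there (`isWeakDeriv_of_tendsto`).

*Finite and nonzero.*  The functions `b = 0` and `b θ = -θ` have finite average bound under the
respective alternatives of the hypothesis (`exists_jet_lintegral_ne_top`).  If `Z` vanished, then
`b = 0` and `∂b/∂θ = -1` almost everywhere, contradicting uniqueness of distributional derivatives
(`lintegral_jetCRB_ne_zero`).

*Bound.*  For an estimator of finite Bayesian error, the domination hypothesis makes its mean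
continuously differentiable, with differentiation under the integral sign
(`IsEstimator.hasFDerivAt_mean`, `IsEstimator.contDiffOn_mean`).  The Cramér–Rao inequality at each
parameter (`IsEstimator.crb_bias_le`), integrated over the prior, shows that its bias lies in `H¹`
and that its Bayesian error is at least `Z` of the bias.
-/

namespace OBB

open Filter Topology
open scoped Matrix

/-! ### Quadratic forms of positive definite matrices -/

theorem trace_mul_mul_transpose {n : ℕ} (M A : Matrix (Fin n) (Fin n) ℝ) :
    Matrix.trace (M * A * M.transpose) = ∑ i, M i ⬝ᵥ A *ᵥ M i := by
  simp only [Matrix.trace, Matrix.diag_apply, Matrix.mul_apply, Matrix.transpose_apply,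
    dotProduct, Matrix.mulVec, Finset.sum_mul, Finset.mul_sum]
  refine Finset.sum_congr rfl fun i _ => ?_
  rw [Finset.sum_comm]
  exact Finset.sum_congr rfl fun j _ => Finset.sum_congr rfl fun k _ => by ring

/-- An upper bound `L` on the quadratic form of a positive definite matrix is a lower bound `1 / L`
on that of its inverse. -/
theorem dotProduct_self_le_mul_inv {n : ℕ} {J : Matrix (Fin n) (Fin n) ℝ} (hJ : J.PosDef) {L : ℝ}
    (hL : 0 < L) (hJL : ∀ v : Fin n → ℝ, v ⬝ᵥ J *ᵥ v ≤ L * (v ⬝ᵥ v)) (v : Fin n → ℝ) :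
    v ⬝ᵥ v ≤ L * (v ⬝ᵥ J⁻¹ *ᵥ v) := by
  have hdet : IsUnit J.det := (Matrix.isUnit_iff_isUnit_det J).1 hJ.isUnit
  have hJw : J *ᵥ (J⁻¹ *ᵥ v) = v := by
    rw [Matrix.mulVec_mulVec, Matrix.mul_nonsing_inv _ hdet, Matrix.one_mulVec]
  have hsym : J.IsSymm := by simpa using hJ.isHermitian
  have hcross : J⁻¹ *ᵥ v ⬝ᵥ J *ᵥ v = v ⬝ᵥ v := by
    rw [Matrix.dotProduct_mulVec, ← Matrix.mulVec_transpose, hsym.eq, hJw]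
  -- The form of `J` is nonnegative at `J⁻¹ v - L⁻¹ v`.
  have h0 := hJ.posSemidef.dotProduct_mulVec_nonneg (J⁻¹ *ᵥ v - L⁻¹ • v)
  have hLv := hJL v
  simp only [star_trivial, Matrix.mulVec_sub, Matrix.mulVec_smul, hJw, sub_dotProduct,
    dotProduct_sub, smul_dotProduct, dotProduct_smul, hcross, smul_eq_mul] at h0
  rw [dotProduct_comm (J⁻¹ *ᵥ v) v] at h0
  have h1 : L⁻¹ * (L⁻¹ * (v ⬝ᵥ J *ᵥ v)) ≤ L⁻¹ * (v ⬝ᵥ v) := by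
    rw [inv_mul_le_iff₀ hL, ← mul_assoc, mul_inv_cancel₀ hL.ne', one_mul, inv_mul_le_iff₀ hL]
    exact hLv
  have h2 : L⁻¹ * (v ⬝ᵥ v) ≤ v ⬝ᵥ J⁻¹ *ᵥ v := by linarith
  rwa [inv_mul_le_iff₀ hL] at h2

theorem sum_sq_le_mul_trace {n : ℕ} {J : Matrix (Fin n) (Fin n) ℝ} (hJ : J.PosDef) {L : ℝ}
    (hL : 0 < L) (hJL : ∀ v : Fin n → ℝ, v ⬝ᵥ J *ᵥ v ≤ L * (v ⬝ᵥ v))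
    (M : Matrix (Fin n) (Fin n) ℝ) :
    ∑ i, ∑ j, M i j ^ 2 ≤ L * Matrix.trace (M * J⁻¹ * M.transpose) := by
  rw [trace_mul_mul_transpose, Finset.mul_sum]
  refine Finset.sum_le_sum fun i _ => ?_
  have := dotProduct_self_le_mul_inv hJ hL hJL (M i)
  simpa [dotProduct, sq] using this

theorem trace_mul_inv_mul_transpose_nonneg {n : ℕ} {J : Matrix (Fin n) (Fin n) ℝ} (hJ : J.PosDef)
    (M : Matrix (Fin n) (Fin n) ℝ) : 0 ≤ Matrix.trace (M * J⁻¹ * M.transpose) := by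
  rw [trace_mul_mul_transpose]
  exact Finset.sum_nonneg fun i _ => by
    simpa using hJ.inv.posSemidef.dotProduct_mulVec_nonneg (M i)

theorem dotProduct_mulVec_le_of_abs_le {n : ℕ} {J : Matrix (Fin n) (Fin n) ℝ} {K : ℝ}
    (hK : ∀ i j, |J i j| ≤ K) (v : Fin n → ℝ) : v ⬝ᵥ J *ᵥ v ≤ n * K * (v ⬝ᵥ v) := by
  have h : ∀ i j, v i * (J i j * v j) ≤ K * ((v i ^ 2 + v j ^ 2) / 2) := fun i j => by
    have h1 : v i * (J i j * v j) ≤ |J i j| * |v i * v j| := by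
      rw [← abs_mul]; exact (le_of_eq (by ring)).trans (le_abs_self _)
    have h2 : |v i * v j| ≤ (v i ^ 2 + v j ^ 2) / 2 := by
      rw [abs_le]; constructor <;> nlinarith [sq_nonneg (v i + v j), sq_nonneg (v i - v j)]
    exact h1.trans (mul_le_mul (hK i j) h2 (abs_nonneg _) ((abs_nonneg _).trans (hK i j)))
  calc v ⬝ᵥ J *ᵥ v = ∑ i, ∑ j, v i * (J i j * v j) := by
        simp [dotProduct, Matrix.mulVec, Finset.mul_sum]
    _ ≤ ∑ i, ∑ j, K * ((v i ^ 2 + v j ^ 2) / 2) :=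
        Finset.sum_le_sum fun i _ => Finset.sum_le_sum fun j _ => h i j
    _ = n * K * (v ⬝ᵥ v) := by
        simp only [← Finset.mul_sum, ← Finset.sum_div, Finset.sum_add_distrib, dotProduct,
          Finset.sum_const, Finset.card_univ, Fintype.card_fin, nsmul_eq_mul, ← sq]
        ring

theorem trace_parallelogram {n : ℕ} (A P Q : Matrix (Fin n) (Fin n) ℝ) :
    2 * Matrix.trace (((1 / 2 : ℝ) • (P + Q)) * A * ((1 / 2 : ℝ) • (P + Q)).transpose) +
      1 / 2 * Matrix.trace ((P - Q) * A * (P - Q).transpose) =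
    Matrix.trace (P * A * P.transpose) + Matrix.trace (Q * A * Q.transpose) := by
  simp only [Matrix.transpose_smul, Matrix.transpose_add, Matrix.transpose_sub, smul_mul_assoc,
    mul_smul_comm, add_mul, mul_add, sub_mul, mul_sub, Matrix.trace_smul, Matrix.trace_add,
    Matrix.trace_sub, smul_eq_mul]
  ring

/-! ### The direct method in `L²` -/

theorem eLpNorm_two_sq {α E : Type*} [MeasurableSpace α] [NormedAddCommGroup E] (π : Measure α)
    (u : α → E) : eLpNorm u 2 π ^ 2 = ∫⁻ θ, ‖u θ‖ₑ ^ 2 ∂π := by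
  have := eLpNorm_nnreal_pow_eq_lintegral (μ := π) (f := u) (p := 2) (by norm_num)
  simpa using this

/-- The direct method of the calculus of variations for a uniformly convex integral functional on
a midpoint-convex, closed set of square integrable functions. -/
theorem exists_unique_minimizer {α E : Type*} [MeasurableSpace α] [NormedAddCommGroup E]
    [NormedSpace ℝ E] [CompleteSpace E] (π : Measure α) (f : α → E → ℝ≥0∞) (K : Set (α → E))
    {c : ℝ≥0∞} (hc0 : c ≠ 0) (hct : c ≠ ⊤)
    (hfin : ∃ u ∈ K, ∫⁻ θ, f θ (u θ) ∂π ≠ ⊤)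
    (hLp : ∀ u ∈ K, MemLp u 2 π)
    (hmid : ∀ u ∈ K, ∀ v ∈ K, (fun θ => (1 / 2 : ℝ) • (u θ + v θ)) ∈ K)
    (hclosed : ∀ u : ℕ → α → E, (∀ k, u k ∈ K) → ∀ v, MemLp v 2 π →
      Tendsto (fun k => eLpNorm (u k - v) 2 π) atTop (𝓝 0) → v ∈ K)
    (hmeas : ∀ u ∈ K, AEMeasurable (fun θ => f θ (u θ)) π)
    (hcont : ∀ᵐ θ ∂π, Continuous (f θ))
    (hconv : ∀ᵐ θ ∂π, ∀ x y,
      2 * f θ ((1 / 2 : ℝ) • (x + y)) + c * ‖x - y‖ₑ ^ 2 ≤ f θ x + f θ y) :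
    ∃ v ∈ K, ∫⁻ θ, f θ (v θ) ∂π ≠ ⊤ ∧ (∀ u ∈ K, ∫⁻ θ, f θ (v θ) ∂π ≤ ∫⁻ θ, f θ (u θ) ∂π) ∧
      ∀ u ∈ K, ∫⁻ θ, f θ (u θ) ∂π = ∫⁻ θ, f θ (v θ) ∂π → u =ᵐ[π] v := by
  set Φ : (α → E) → ℝ≥0∞ := fun u => ∫⁻ θ, f θ (u θ) ∂π with hΦ
  set s : ℝ≥0∞ := sInf (Φ '' K) with hs
  have hsle : ∀ u ∈ K, s ≤ Φ u := fun u hu => sInf_le ⟨u, hu, rfl⟩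
  obtain ⟨u₀, hu₀, hu₀fin⟩ := hfin
  have hst : s ≠ ⊤ := ne_top_of_le_ne_top hu₀fin (hsle u₀ hu₀)
  -- Integrated uniform convexity: near-minimizers are close to each other.
  have key : ∀ u ∈ K, ∀ v ∈ K, 2 * s + c * eLpNorm (u - v) 2 π ^ 2 ≤ Φ u + Φ v := by
    intro u hu v hv
    calc 2 * s + c * eLpNorm (u - v) 2 π ^ 2
        ≤ 2 * Φ (fun θ => (1 / 2 : ℝ) • (u θ + v θ)) + c * eLpNorm (u - v) 2 π ^ 2 := by
          gcongr; exact hsle _ (hmid u hu v hv)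
      _ = ∫⁻ θ, (2 * f θ ((1 / 2 : ℝ) • (u θ + v θ)) + c * ‖u θ - v θ‖ₑ ^ 2) ∂π := by
          rw [lintegral_add_left' ((hmeas _ (hmid u hu v hv)).const_mul 2),
            lintegral_const_mul' _ _ (by norm_num), lintegral_const_mul' _ _ hct, eLpNorm_two_sq]
          rfl
      _ ≤ ∫⁻ θ, (f θ (u θ) + f θ (v θ)) ∂π :=
          lintegral_mono_ae (hconv.mono fun θ h => h _ _)
      _ = Φ u + Φ v := lintegral_add_left' (hmeas u hu) _
  have key' : ∀ u ∈ K, ∀ v ∈ K, ∀ δ : ℝ≥0∞, Φ u ≤ s + δ → Φ v ≤ s + δ →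
      c * eLpNorm (u - v) 2 π ^ 2 ≤ 2 * δ := by
    intro u hu v hv δ h1 h2
    have h := (key u hu v hv).trans (add_le_add h1 h2)
    have h3 : s + δ + (s + δ) = 2 * s + 2 * δ := by ring
    rw [h3] at h
    exact (ENNReal.add_le_add_iff_left (ENNReal.mul_ne_top (by norm_num) hst)).1 h
  -- A minimizing sequence, with a rate that makes it summably Cauchy in `L²`.
  set B : ℕ → ℝ≥0∞ := fun k => (2⁻¹ : ℝ≥0∞) ^ k with hB
  have hB0 : ∀ k, B k ≠ 0 := fun k => pow_ne_zero _ (by simp)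
  have hBt : ∀ k, B k ≠ ⊤ := fun k => ENNReal.pow_ne_top (by simp)
  set δ : ℕ → ℝ≥0∞ := fun k => c * B k ^ 2 / 4 with hδ
  have hδ0 : ∀ k, δ k ≠ 0 := fun k =>
    (ENNReal.div_pos (mul_ne_zero hc0 (pow_ne_zero _ (hB0 k))) (by norm_num)).ne'
  have hBanti : Antitone B := fun a b hab => pow_le_pow_right_of_le_one' (by simp) hab
  have hδanti : Antitone δ := fun a b hab => by
    simp only [hδ]; gcongr; exact hBanti hab
  have hex : ∀ k, ∃ u ∈ K, Φ u ≤ s + δ k := fun k => by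
    have : s < s + δ k := ENNReal.lt_add_right hst (hδ0 k)
    obtain ⟨_, ⟨u, hu, rfl⟩, hlt⟩ := sInf_lt_iff.1 this
    exact ⟨u, hu, hlt.le⟩
  choose u huK huΦ using hex
  have hcauchy : ∀ N k l : ℕ, N ≤ k → N ≤ l → eLpNorm (u k - u l) 2 π < B N := by
    intro N k l hk hl
    have h := key' _ (huK k) _ (huK l) (δ N)
      ((huΦ k).trans (by gcongr; exact hδanti hk)) ((huΦ l).trans (by gcongr; exact hδanti hl))
    by_contra! hcon
    have h2 : c * B N ^ 2 ≤ 2 * δ N := le_trans (by gcongr) h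
    have h3 : 2 * δ N = c * B N ^ 2 / 2 := by
      simp only [hδ, div_eq_mul_inv]
      rw [show (4 : ℝ≥0∞) = 2 * 2 by norm_num, ENNReal.mul_inv (by simp) (by simp)]
      calc 2 * (c * B N ^ 2 * (2⁻¹ * 2⁻¹)) = c * B N ^ 2 * 2⁻¹ * (2 * 2⁻¹) := by ring
        _ = _ := by rw [ENNReal.mul_inv_cancel (by norm_num) (by norm_num), mul_one]
    rw [h3] at h2
    exact absurd h2 (not_le.2 (ENNReal.half_lt_self (mul_ne_zero hc0 (pow_ne_zero _ (hB0 N)))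
      (ENNReal.mul_ne_top hct (ENNReal.pow_ne_top (hBt N)))))
  have hBsum : ∑' k, B k ≠ ⊤ := by
    simp only [hB, ENNReal.tsum_geometric, ENNReal.one_sub_inv_two, inv_inv]; norm_num
  obtain ⟨v, hvLp, hv⟩ := Lp.cauchy_complete_eLpNorm (by norm_num) (fun k => hLp _ (huK k))
    hBsum hcauchy
  have hvK : v ∈ K := hclosed u huK v hvLp hv
  have hΦv : Φ v = s := by
    refine le_antisymm ?_ (hsle v hvK)
    obtain ⟨ns, hns, hae⟩ := (tendstoInMeasure_of_tendsto_eLpNorm (by norm_num)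
      (fun k => (hLp _ (huK k)).1) hvLp.1 hv).exists_seq_tendsto_ae
    have hΦlim : Tendsto (fun k => Φ (u (ns k))) atTop (𝓝 s) := by
      have hδlim : Tendsto (fun k => s + δ (ns k)) atTop (𝓝 (s + 0)) := by
        refine tendsto_const_nhds.add ?_
        have hB' : Tendsto B atTop (𝓝 0) :=
          ENNReal.tendsto_pow_atTop_nhds_zero_of_lt_one (by simp)
        have h1 : Tendsto (fun k => c * B k ^ 2 / 4) atTop (𝓝 (c * 0 ^ 2 / 4)) :=
          ENNReal.Tendsto.div_const (ENNReal.Tendsto.const_mul (ENNReal.Tendsto.pow hB') (Or.inr hct))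
            (Or.inr (by norm_num))
        simp only [ne_eq, OfNat.ofNat_ne_zero, not_false_eq_true, zero_pow, mul_zero,
          ENNReal.zero_div] at h1
        exact h1.comp hns.tendsto_atTop
      rw [add_zero] at hδlim
      exact tendsto_of_tendsto_of_tendsto_of_le_of_le tendsto_const_nhds hδlim
        (fun k => hsle _ (huK _)) (fun k => huΦ _)
    calc Φ v = ∫⁻ θ, liminf (fun k => f θ (u (ns k) θ)) atTop ∂π := by
          refine lintegral_congr_ae ?_
          filter_upwards [hae, hcont] with θ h1 h2
          exact (((h2.tendsto _).comp h1).liminf_eq).symm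
      _ ≤ liminf (fun k => Φ (u (ns k))) atTop := lintegral_liminf_le' fun k => hmeas _ (huK _)
      _ = s := hΦlim.liminf_eq
  refine ⟨v, hvK, hΦv.trans_ne hst, fun w hw => hΦv.trans_le (hsle w hw), fun w hw hwv => ?_⟩
  have h := key' w hw v hvK 0 (by simpa using (hwv.trans hΦv).le) (by simpa using hΦv.le)
  rw [mul_zero, nonpos_iff_eq_zero, mul_eq_zero, or_iff_right hc0, sq_eq_zero_iff,
    eLpNorm_eq_zero_iff ((hLp w hw).1.sub hvLp.1) (by norm_num)] at h
  filter_upwards [h] with θ hθ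
  exact sub_eq_zero.1 hθ

section

variable {n : ℕ} {Θ : Set (Param n)} {q : Param n → ℝ}

/-! ### The prior measure -/

theorem IsPrior.isProbabilityMeasure (hq : IsPrior Θ q) :
    IsProbabilityMeasure (priorMeasure Θ q) :=
  ⟨by rw [priorMeasure, withDensity_apply _ MeasurableSet.univ, Measure.restrict_univ, hq.mass]⟩

theorem lintegral_priorMeasure (hq : IsPrior Θ q) (g : Param n → ℝ≥0∞) :
    ∫⁻ θ, g θ ∂priorMeasure Θ q = ∫⁻ θ in Θ, g θ * ENNReal.ofReal (q θ) := by
  rw [priorMeasure, lintegral_withDensity_eq_lintegral_mul_non_measurable₀ _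
    hq.measurable.ennreal_ofReal.aemeasurable (ae_of_all _ fun _ => ENNReal.ofReal_lt_top)]
  exact lintegral_congr fun θ => mul_comm _ _

theorem restrict_absolutelyContinuous_prior (hq : IsPrior Θ q) :
    volume.restrict Θ ≪ priorMeasure Θ q := by
  refine withDensity_absolutelyContinuous' hq.measurable.ennreal_ofReal.aemeasurable ?_
  filter_upwards [ae_restrict_mem hq.isOpen.measurableSet] with θ hθ
  simpa using hq.pos θ hθ

theorem prior_absolutelyContinuous_restrict : priorMeasure Θ q ≪ volume.restrict Θ :=
  withDensity_absolutelyContinuous _ _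

theorem integral_prior_mul_div (hq : IsPrior Θ q) (f φ : Param n → ℝ) :
    ∫ θ, f θ * (φ θ * (q θ)⁻¹) ∂priorMeasure Θ q = ∫ θ in Θ, f θ * φ θ := by
  rw [priorMeasure, integral_withDensity_eq_integral_toReal_smul₀
    hq.measurable.ennreal_ofReal.aemeasurable (ae_of_all _ fun _ => ENNReal.ofReal_lt_top)]
  refine setIntegral_congr_fun hq.isOpen.measurableSet fun θ hθ => ?_
  have := hq.pos θ hθ
  simp only [smul_eq_mul, ENNReal.toReal_ofReal this.le]
  field_simp

theorem integrable_prior_mul_div_iff (hq : IsPrior Θ q) (f φ : Param n → ℝ) :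
    Integrable (fun θ => f θ * (φ θ * (q θ)⁻¹)) (priorMeasure Θ q) ↔
      IntegrableOn (fun θ => f θ * φ θ) Θ := by
  rw [priorMeasure, integrable_withDensity_iff_integrable_smul₀'
    hq.measurable.ennreal_ofReal.aemeasurable (ae_of_all _ fun _ => ENNReal.ofReal_lt_top)]
  refine integrableOn_congr_fun (fun θ hθ => ?_) hq.isOpen.measurableSet
  have := hq.pos θ hθ
  simp only [smul_eq_mul, ENNReal.toReal_ofReal this.le]
  field_simp

/-- Since `1 / q` is locally integrable, a bounded function with compact support in `Θ`, divided
by the density, is square integrable under the prior.  By `integral_prior_mul_div`, pairing with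
this quotient under the prior is Lebesgue integration against the function itself. -/
theorem memLp_mul_inv (hq : IsPrior Θ q) (hq_inv : LocallyIntegrableOn (fun θ => (q θ)⁻¹) Θ)
    {φ : Param n → ℝ} (hφ : Measurable φ) {k : Set (Param n)} (hk : IsCompact k) (hkΘ : k ⊆ Θ)
    (hφk : ∀ θ ∉ k, φ θ = 0) {C : ℝ} (hC : ∀ θ, |φ θ| ≤ C) :
    MemLp (fun θ => φ θ * (q θ)⁻¹) 2 (priorMeasure Θ q) := by
  have hm : Measurable fun θ => φ θ * (q θ)⁻¹ := hφ.mul hq.measurable.inv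
  rw [memLp_two_iff_integrable_sq hm.aestronglyMeasurable]
  have h1 : (fun θ => (φ θ * (q θ)⁻¹) ^ 2) =
      fun θ => φ θ * (q θ)⁻¹ * (φ θ * (q θ)⁻¹) := by ext θ; ring
  rw [h1, integrable_prior_mul_div_iff hq]
  have h2 : IntegrableOn (fun θ => φ θ * (q θ)⁻¹ * φ θ) k := by
    refine Integrable.mono' ((hq_inv.integrableOn_compact_subset hkΘ hk).norm.const_mul (C * C))
      (hm.mul hφ).aestronglyMeasurable (ae_of_all _ fun θ => ?_)
    rw [norm_mul, norm_mul, mul_right_comm, Real.norm_eq_abs (φ θ)]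
    gcongr
    · exact (abs_nonneg _).trans (hC θ)
    · exact hC θ
    · exact hC θ
  refine ((integrableOn_iff_integrable_of_support_subset fun θ hθ => ?_).1 h2).integrableOn
  by_contra hcon
  exact hθ (by simp [hφk θ hcon])

theorem locallyIntegrableOn_of_memLp_prior (hq : IsPrior Θ q)
    (hq_inv : LocallyIntegrableOn (fun θ => (q θ)⁻¹) Θ) {f : Param n → ℝ}
    (hf : MemLp f 2 (priorMeasure Θ q)) : LocallyIntegrableOn f Θ := by
  rw [locallyIntegrableOn_iff hq.isOpen.isLocallyClosed]
  intro k hkΘ hk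
  have h1 : MemLp (fun θ => k.indicator (fun _ => (1 : ℝ)) θ * (q θ)⁻¹) 2 (priorMeasure Θ q) :=
    memLp_mul_inv hq hq_inv (measurable_const.indicator hk.measurableSet) hk hkΘ
      (fun θ hθ => Set.indicator_of_notMem hθ _) (C := 1)
      fun θ => by by_cases h : θ ∈ k <;> simp [h]
  have h2 := (integrable_prior_mul_div_iff hq _ _).1 (hf.integrable_mul h1)
  refine (integrableOn_congr_fun (fun θ hθ => ?_) hk.measurableSet).1 (h2.mono_set hkΘ)
  simp [hθ]

/-! ### Weak derivatives -/

theorem partialD_eq_zero_of_notMem_tsupport {φ : Param n → ℝ} {θ : Param n}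
    (hθ : θ ∉ tsupport φ) (j : Fin n) : partialD φ j θ = 0 := by
  have := fun h => hθ (tsupport_fderiv_apply_subset ℝ (EuclideanSpace.single j (1 : ℝ)) h)
  exact image_eq_zero_of_notMem_tsupport (f := fun θ => fderiv ℝ φ θ (EuclideanSpace.single j 1))
    this

theorem continuous_partialD {φ : Param n → ℝ} (hφ : ContDiff ℝ ∞ φ) (j : Fin n) :
    Continuous (partialD φ j) :=
  (hφ.continuous_fderiv (by simp)).clm_apply continuous_const

theorem integrable_mul_of_tsupport_subset {f φ : Param n → ℝ} (hf : LocallyIntegrableOn f Θ)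
    (hφ : Continuous φ) {k : Set (Param n)} (hk : IsCompact k) (hkΘ : k ⊆ Θ)
    (hφk : ∀ θ ∉ k, φ θ = 0) : Integrable (fun θ => f θ * φ θ) := by
  have h := (hf.integrableOn_compact_subset hkΘ hk).mul_continuousOn hφ.continuousOn hk
  refine (integrableOn_iff_integrable_of_support_subset fun θ hθ => ?_).1 h
  by_contra hcon
  exact hθ (by simp [hφk θ hcon])

theorem integrable_mul_partialD {f φ : Param n → ℝ} (hf : LocallyIntegrableOn f Θ)
    (hφ : ContDiff ℝ ∞ φ) (hc : HasCompactSupport φ) (hs : tsupport φ ⊆ Θ) (j : Fin n) :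
    Integrable (fun θ => f θ * partialD φ j θ) :=
  integrable_mul_of_tsupport_subset hf (continuous_partialD hφ j) hc hs fun _ h =>
    partialD_eq_zero_of_notMem_tsupport h j

theorem integrable_mul_test {f φ : Param n → ℝ} (hf : LocallyIntegrableOn f Θ)
    (hφ : ContDiff ℝ ∞ φ) (hc : HasCompactSupport φ) (hs : tsupport φ ⊆ Θ) :
    Integrable (fun θ => f θ * φ θ) :=
  integrable_mul_of_tsupport_subset hf hφ.continuous hc hs fun _ h =>
    image_eq_zero_of_notMem_tsupport h

theorem IsWeakDeriv.congr {b b' : Param n → Param n} {D D' : Param n → Matrix (Fin n) (Fin n) ℝ}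
    (h : IsWeakDeriv Θ b D) (hb : b =ᵐ[volume.restrict Θ] b')
    (hD : D =ᵐ[volume.restrict Θ] D') : IsWeakDeriv Θ b' D' := by
  refine ⟨fun i => (h.1 i).congr (hb.mono fun θ hθ => by simp only [hθ]),
    fun i j => (h.2.1 i j).congr (hD.mono fun θ hθ => by simp only [hθ]), ?_⟩
  intro φ h1 h2 h3 i j
  rw [← integral_congr_ae (hb.mono fun θ hθ => by simp only [hθ] :
      (fun θ => b θ i * partialD φ j θ) =ᵐ[volume.restrict Θ] _),
    h.2.2 φ h1 h2 h3 i j]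
  congr 1
  exact integral_congr_ae (hD.mono fun θ hθ => by simp only [hθ])

theorem IsWeakDeriv.unique (hΘ : IsOpen Θ) {b : Param n → Param n}
    {D D' : Param n → Matrix (Fin n) (Fin n) ℝ}
    (h : IsWeakDeriv Θ b D) (h' : IsWeakDeriv Θ b D') : D =ᵐ[volume.restrict Θ] D' := by
  have key : ∀ i j, ∀ᵐ θ ∂volume.restrict Θ, D θ i j = D' θ i j := by
    intro i j
    rw [ae_restrict_iff' hΘ.measurableSet]
    have := IsOpen.ae_eq_zero_of_integral_contDiff_smul_eq_zero (μ := volume) hΘ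
      ((h.2.1 i j).sub (h'.2.1 i j)) ?_
    · filter_upwards [this] with θ hθ hm
      exact sub_eq_zero.1 (hθ hm)
    intro φ h1 h2 h3
    have e1 := h.2.2 φ h1 h2 h3 i j
    rw [h'.2.2 φ h1 h2 h3 i j, neg_inj] at e1
    have e2 : ∀ D : Param n → Matrix (Fin n) (Fin n) ℝ,
        ∫ θ in Θ, D θ i j * φ θ = ∫ θ, D θ i j * φ θ := fun D =>
      setIntegral_eq_integral_of_forall_compl_eq_zero fun θ hθ => by
        rw [image_eq_zero_of_notMem_tsupport fun h => hθ (h3 h), mul_zero]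
    rw [e2, e2] at e1
    calc ∫ θ, φ θ • (D θ i j - D' θ i j) = ∫ θ, (D θ i j * φ θ - D' θ i j * φ θ) := by
          congr 1; ext θ; simp only [smul_eq_mul]; ring
      _ = 0 := by
          rw [integral_sub (integrable_mul_test (h.2.1 i j) h1 h2 h3)
            (integrable_mul_test (h'.2.1 i j) h1 h2 h3), e1, sub_self]
  have := ae_all_iff.2 fun i => ae_all_iff.2 fun j => key i j
  filter_upwards [this] with θ hθ
  ext i j; exact hθ i j

theorem isWeakDeriv_weakDeriv {b : Param n → Param n} (h : ∃ D, IsWeakDeriv Θ b D) :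
    IsWeakDeriv Θ b (weakDeriv Θ b) := by
  rw [weakDeriv, dif_pos h]; exact h.choose_spec

theorem IsWeakDeriv.weakDeriv_ae_eq (hΘ : IsOpen Θ) {b : Param n → Param n}
    {D : Param n → Matrix (Fin n) (Fin n) ℝ} (h : IsWeakDeriv Θ b D) :
    weakDeriv Θ b =ᵐ[volume.restrict Θ] D :=
  (isWeakDeriv_weakDeriv ⟨D, h⟩).unique hΘ h

theorem IsWeakDeriv.midpoint {b b' : Param n → Param n}
    {D D' : Param n → Matrix (Fin n) (Fin n) ℝ}
    (h : IsWeakDeriv Θ b D) (h' : IsWeakDeriv Θ b' D') :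
    IsWeakDeriv Θ (fun θ => (1 / 2 : ℝ) • (b θ + b' θ)) (fun θ => (1 / 2 : ℝ) • (D θ + D' θ)) := by
  refine ⟨fun i => ((h.1 i).add (h'.1 i)).smul (1 / 2 : ℝ),
    fun i j => ((h.2.1 i j).add (h'.2.1 i j)).smul (1 / 2 : ℝ), ?_⟩
  intro φ h1 h2 h3 i j
  have e1 : (fun θ => ((1 / 2 : ℝ) • (b θ + b' θ)) i * partialD φ j θ) = fun θ =>
      (1 / 2 : ℝ) * (b θ i * partialD φ j θ + b' θ i * partialD φ j θ) := by
    ext θ; simp only [PiLp.smul_apply, PiLp.add_apply, smul_eq_mul]; ring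
  have e2 : (fun θ => ((1 / 2 : ℝ) • (D θ + D' θ)) i j * φ θ) = fun θ =>
      (1 / 2 : ℝ) * (D θ i j * φ θ + D' θ i j * φ θ) := by
    ext θ; simp only [Matrix.smul_apply, Matrix.add_apply, smul_eq_mul]; ring
  rw [e1, e2, integral_const_mul, integral_const_mul,
    integral_add (integrable_mul_partialD (h.1 i) h1 h2 h3 j).integrableOn
      (integrable_mul_partialD (h'.1 i) h1 h2 h3 j).integrableOn,
    integral_add (integrable_mul_test (h.2.1 i j) h1 h2 h3).integrableOn
      (integrable_mul_test (h'.2.1 i j) h1 h2 h3).integrableOn,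
    h.2.2 φ h1 h2 h3 i j, h'.2.2 φ h1 h2 h3 i j]
  ring

/-- The classical derivative of a continuously differentiable function is its distributional
derivative. -/
theorem isWeakDeriv_of_contDiffOn (hΘ : IsOpen Θ) {b : Param n → Param n}
    (hb : ∀ i, ContDiffOn ℝ 1 (fun θ => b θ i) Θ) :
    IsWeakDeriv Θ b (fun θ => Matrix.of fun i j => partialD (fun ϑ => b ϑ i) j θ) := by
  have hb1 : ∀ i, LocallyIntegrableOn (fun θ => b θ i) Θ := fun i =>
    (hb i).continuousOn.locallyIntegrableOn hΘ.measurableSet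
  have hb2 : ∀ i j, LocallyIntegrableOn (fun θ => partialD (fun ϑ => b ϑ i) j θ) Θ := fun i j =>
    (((hb i).continuousOn_fderiv_of_isOpen hΘ le_rfl).clm_apply
      continuousOn_const).locallyIntegrableOn hΘ.measurableSet
  refine ⟨hb1, hb2, ?_⟩
  intro φ h1 h2 h3 i j
  rw [setIntegral_eq_integral_of_forall_compl_eq_zero fun θ hθ => by
      rw [partialD_eq_zero_of_notMem_tsupport (fun h => hθ (h3 h)), mul_zero],
    setIntegral_eq_integral_of_forall_compl_eq_zero fun θ hθ => by
      rw [image_eq_zero_of_notMem_tsupport fun h => hθ (h3 h), mul_zero]]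
  exact integral_mul_fderiv_eq_neg_fderiv_mul_of_integrable
    (integrable_mul_test (hb2 i j) h1 h2 h3) (integrable_mul_partialD (hb1 i) h1 h2 h3 j)
    (integrable_mul_test (hb1 i) h1 h2 h3)
    (fun θ hθ => ((hb i).differentiableOn one_ne_zero).differentiableAt (hΘ.mem_nhds (h3 hθ)))
    (fun θ _ => (h1.differentiable (by simp)).differentiableAt)

/-- The possible values of a function and of its derivative matrix, as one Banach space.  The norm is
the maximum of the Euclidean norm of the value and the largest entry of the derivative; only its
equivalence to the Hilbert norm matters. -/
abbrev Jet (n : ℕ) : Type := Param n × (Fin n → Fin n → ℝ)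

theorem tendsto_integral_clm_mul {α E : Type*} [MeasurableSpace α] [NormedAddCommGroup E]
    [NormedSpace ℝ E] {π : Measure α} {u : ℕ → α → E} {v : α → E} (hu : ∀ k, MemLp (u k) 2 π)
    (hv : MemLp v 2 π) (huv : Tendsto (fun k => eLpNorm (u k - v) 2 π) atTop (𝓝 0))
    (L : E →L[ℝ] ℝ) {ψ : α → ℝ} (hψ : MemLp ψ 2 π) :
    Tendsto (fun k => ∫ θ, L (u k θ) * ψ θ ∂π) atTop (𝓝 (∫ θ, L (v θ) * ψ θ ∂π)) := by
  refine tendsto_integral_of_L1' _ ((L.comp_memLp' hv).1.mul hψ.1)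
    (Eventually.of_forall fun k => MemLp.integrable_mul (L.comp_memLp' (hu k)) hψ) ?_
  have hle : ∀ k, eLpNorm ((fun θ => L (u k θ) * ψ θ) - fun θ => L (v θ) * ψ θ) 1 π ≤
      ‖L‖₊ * eLpNorm (u k - v) 2 π * eLpNorm ψ 2 π := fun k => by
    refine le_trans (le_of_eq ?_) (eLpNorm_le_eLpNorm_mul_eLpNorm_of_nnnorm (p := 2) (q := 2) (r := 1)
      ((hu k).1.sub hv.1) hψ.1 (fun x y => L x * y) ‖L‖₊ (ae_of_all _ fun θ => ?_))
    · congr 1; ext θ; simp [sub_mul]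
    · rw [nnnorm_mul]; gcongr; exact L.le_opNNNorm _
  have hlim : Tendsto (fun k => ‖L‖₊ * eLpNorm (u k - v) 2 π * eLpNorm ψ 2 π) atTop (𝓝 0) := by
    have := ENNReal.Tendsto.mul_const (b := eLpNorm ψ 2 π) (ENNReal.Tendsto.const_mul
      (a := (‖L‖₊ : ℝ≥0∞)) huv (Or.inr (by simp))) (Or.inr hψ.2.ne)
    simpa using this
  exact tendsto_of_tendsto_of_tendsto_of_le_of_le tendsto_const_nhds hlim (fun _ => zero_le)
    hle

/-- Pairs of a function and its distributional derivative are closed under convergence in `L²` of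
the prior. -/
theorem isWeakDeriv_of_tendsto (hq : IsPrior Θ q)
    (hq_inv : LocallyIntegrableOn (fun θ => (q θ)⁻¹) Θ) {u : ℕ → Param n → Jet n}
    {v : Param n → Jet n} (hu : ∀ k, MemLp (u k) 2 (priorMeasure Θ q))
    (hv : MemLp v 2 (priorMeasure Θ q))
    (huv : Tendsto (fun k => eLpNorm (u k - v) 2 (priorMeasure Θ q)) atTop (𝓝 0))
    (hw : ∀ k, IsWeakDeriv Θ (fun θ => (u k θ).1) fun θ => Matrix.of (u k θ).2) :
    IsWeakDeriv Θ (fun θ => (v θ).1) fun θ => Matrix.of (v θ).2 := by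
  let L₁ : Fin n → Jet n →L[ℝ] ℝ := fun i =>
    (EuclideanSpace.proj i).comp (ContinuousLinearMap.fst ℝ _ _)
  let L₂ : Fin n → Fin n → Jet n →L[ℝ] ℝ := fun i j =>
    ((ContinuousLinearMap.proj (R := ℝ) (φ := fun _ : Fin n => ℝ) j).comp
      (ContinuousLinearMap.proj (R := ℝ) (φ := fun _ : Fin n => Fin n → ℝ) i)).comp
      (ContinuousLinearMap.snd ℝ _ _)
  refine ⟨fun i => locallyIntegrableOn_of_memLp_prior hq hq_inv ((L₁ i).comp_memLp' hv),
    fun i j => locallyIntegrableOn_of_memLp_prior hq hq_inv ((L₂ i j).comp_memLp' hv), ?_⟩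
  intro φ h1 h2 h3 i j
  have htest : ∀ ψ : Param n → ℝ, Continuous ψ → (∀ θ ∉ tsupport φ, ψ θ = 0) →
      MemLp (fun θ => ψ θ * (q θ)⁻¹) 2 (priorMeasure Θ q) := by
    intro ψ hψ hψ0
    obtain ⟨C, hC⟩ := (HasCompactSupport.intro h2 hψ0).exists_bound_of_continuous hψ
    exact memLp_mul_inv hq hq_inv hψ.measurable h2 h3 hψ0 hC
  have t1 := tendsto_integral_clm_mul hu hv huv (L₁ i)
    (htest _ (continuous_partialD h1 j) fun θ h => partialD_eq_zero_of_notMem_tsupport h j)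
  have t2 := tendsto_integral_clm_mul hu hv huv (L₂ i j)
    (htest φ h1.continuous fun θ h => image_eq_zero_of_notMem_tsupport h)
  simp only [integral_prior_mul_div hq] at t1 t2
  exact tendsto_nhds_unique (t1.congr fun k => (hw k).2.2 φ h1 h2 h3 i j) t2.neg

end

section

/-! ### The Fisher information -/

variable {X : Type*} [MeasurableSpace X] {μ : Measure X} {n : ℕ} {Θ : Set (Param n)}
  {p : X → Param n → ℝ}

theorem IsRegularModel.differentiableAt (hp : IsRegularModel μ Θ p) (hΘ : IsOpen Θ) (x : X)
    {θ : Param n} (hθ : θ ∈ Θ) : DifferentiableAt ℝ (p x) θ :=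
  ((hp.contDiff x).differentiableOn one_ne_zero).differentiableAt (hΘ.mem_nhds hθ)

/-- At a zero of the density its derivative vanishes, because the zero is a minimum. -/
theorem IsRegularModel.partialD_eq_zero (hp : IsRegularModel μ Θ p) (hΘ : IsOpen Θ) {x : X}
    {θ : Param n} (hθ : θ ∈ Θ) (h0 : p x θ = 0) (j : Fin n) : partialD (p x) j θ = 0 := by
  have : IsLocalMin (p x) θ := by
    filter_upwards [hΘ.mem_nhds hθ] with ϑ hϑ
    rw [h0]; exact hp.nonneg x ϑ hϑ
  rw [partialD, this.fderiv_eq_zero]; rfl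

theorem IsRegularModel.fisher_integrand_eq (hp : IsRegularModel μ Θ p) (hΘ : IsOpen Θ)
    {θ : Param n} (hθ : θ ∈ Θ) (x : X) (i j : Fin n) :
    partialD (fun ϑ => Real.log (p x ϑ)) i θ * partialD (fun ϑ => Real.log (p x ϑ)) j θ * p x θ =
      partialD (p x) i θ * partialD (p x) j θ / p x θ := by
  by_cases h0 : p x θ = 0
  · simp [h0]
  · have : ∀ k, partialD (fun ϑ => Real.log (p x ϑ)) k θ = (p x θ)⁻¹ * partialD (p x) k θ :=
      fun k => by
        rw [partialD, fderiv.log (hp.differentiableAt hΘ x hθ) h0]; rfl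
    rw [this, this]
    field_simp

theorem IsRegularModel.fisher_apply (hp : IsRegularModel μ Θ p) (hΘ : IsOpen Θ)
    {θ : Param n} (hθ : θ ∈ Θ) (i j : Fin n) :
    fisher μ p θ i j = ∫ x, partialD (p x) i θ * partialD (p x) j θ / p x θ ∂μ := by
  simp only [fisher, Matrix.of_apply, hp.fisher_integrand_eq hΘ hθ]

theorem IsRegularModel.measurable_partialD (hp : IsRegularModel μ Θ p) (hΘ : IsOpen Θ)
    {θ : Param n} (hθ : θ ∈ Θ) (j : Fin n) : Measurable fun x => partialD (p x) j θ := by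
  set e : Param n := EuclideanSpace.single j 1
  have hev : ∀ᶠ k : ℕ in atTop, θ + (k : ℝ)⁻¹ • e ∈ Θ := by
    have h1 : Tendsto (fun k : ℕ => θ + (k : ℝ)⁻¹ • e) atTop (𝓝 (θ + (0 : ℝ) • e)) :=
      tendsto_const_nhds.add ((tendsto_inv_atTop_nhds_zero_nat (𝕜 := ℝ)).smul_const e)
    rw [zero_smul, add_zero] at h1
    exact h1 (hΘ.mem_nhds hθ)
  obtain ⟨N, hN⟩ := eventually_atTop.1 hev
  -- The partial derivative is a limit of difference quotients; the shift by `N` keeps all of them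
  -- inside `Θ`, where the density is measurable in `x`.
  refine measurable_of_tendsto_metrizable
    (f := fun k : ℕ => fun x => ((k + N : ℕ) : ℝ) * (p x (θ + ((k + N : ℕ) : ℝ)⁻¹ • e) - p x θ))
    (fun k => ?_) (tendsto_pi_nhds.2 fun x => ?_)
  · exact ((hp.measurable _ (hN _ (Nat.le_add_left _ _))).sub (hp.measurable _ hθ)).const_mul _
  · refine (hp.differentiableAt hΘ x hθ).hasFDerivAt.lim e
      (c := fun k : ℕ => ((k + N : ℕ) : ℝ)) ?_
    simp only [Real.norm_natCast]
    exact tendsto_natCast_atTop_atTop.comp (tendsto_add_atTop_nat N)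

theorem IsRegularModel.continuousOn_fderiv (hp : IsRegularModel μ Θ p) (hΘ : IsOpen Θ) (x : X) :
    ContinuousOn (fderiv ℝ (p x)) Θ :=
  (hp.contDiff x).continuousOn_fderiv_of_isOpen hΘ le_rfl

theorem IsRegularModel.aemeasurable_fisher [SigmaFinite μ] (hp : IsRegularModel μ Θ p)
    (hΘ : IsOpen Θ) (i j : Fin n) :
    AEMeasurable (fun θ => fisher μ p θ i j) (volume.restrict Θ) := by
  refine aemeasurable_restrict_of_measurable_subtype hΘ.measurableSet ?_
  have hp' : Measurable (Function.uncurry fun (θ : Θ) (x : X) => p x θ) :=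
    measurable_uncurry_of_continuous_of_measurable
      (fun x => continuousOn_iff_continuous_domRestrict.1 (hp.contDiff x).continuousOn)
      fun θ => hp.measurable θ θ.2
  have hd : ∀ k, Measurable (Function.uncurry fun (θ : Θ) (x : X) => partialD (p x) k θ) :=
    fun k => measurable_uncurry_of_continuous_of_measurable
      (fun x => continuousOn_iff_continuous_domRestrict.1
        ((hp.continuousOn_fderiv hΘ x).clm_apply continuousOn_const))
      fun θ => hp.measurable_partialD hΘ θ.2 k
  have h := (((hd i).mul (hd j)).div hp').stronglyMeasurable
  have h2 := StronglyMeasurable.integral_prod_right (ν := μ)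
    (f := fun (θ : Θ) (x : X) => partialD (p x) i θ * partialD (p x) j θ / p x θ) h
  simp only [hp.fisher_apply hΘ (Subtype.prop _)]
  exact h2.measurable

theorem aemeasurable_det {α : Type*} [MeasurableSpace α] {π : Measure α}
    {A : α → Matrix (Fin n) (Fin n) ℝ} (hA : ∀ i j, AEMeasurable (fun θ => A θ i j) π) :
    AEMeasurable (fun θ => (A θ).det) π := by
  simp only [Matrix.det_apply]
  exact Finset.aemeasurable_fun_sum _ fun σ _ =>
    (Finset.aemeasurable_fun_prod _ fun i _ => hA _ _).const_smul _

theorem aemeasurable_inv_apply {α : Type*} [MeasurableSpace α] {π : Measure α}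
    {A : α → Matrix (Fin n) (Fin n) ℝ} (hA : ∀ i j, AEMeasurable (fun θ => A θ i j) π)
    (i j : Fin n) : AEMeasurable (fun θ => (A θ)⁻¹ i j) π := by
  simp only [Matrix.inv_def, Matrix.smul_apply, Ring.inverse_eq_inv', smul_eq_mul,
    Matrix.adjugate_apply]
  refine (aemeasurable_det hA).inv.mul (aemeasurable_det fun k l => ?_)
  simp only [Matrix.updateRow_apply]
  split_ifs
  · exact aemeasurable_const
  · exact hA k l

theorem aemeasurable_trace_mul_inv {α : Type*} [MeasurableSpace α] {π : Measure α}
    {A M : α → Matrix (Fin n) (Fin n) ℝ} (hA : ∀ i j, AEMeasurable (fun θ => A θ i j) π)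
    (hM : ∀ i j, AEMeasurable (fun θ => M θ i j) π) :
    AEMeasurable (fun θ => Matrix.trace (M θ * (A θ)⁻¹ * (M θ).transpose)) π := by
  simp only [trace_mul_mul_transpose, dotProduct, Matrix.mulVec]
  exact Finset.aemeasurable_fun_sum _ fun i _ => Finset.aemeasurable_fun_sum _ fun j _ =>
    (hM i j).mul (Finset.aemeasurable_fun_sum _ fun k _ =>
      (aemeasurable_inv_apply hA j k).mul (hM i k))

/-- Boundedness of the Fisher information makes the Cramér–Rao quadratic form uniformly coercive
in the derivative. -/
theorem IsRegularModel.exists_coercive (hp : IsRegularModel μ Θ p) :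
    ∃ L : ℝ, 1 ≤ L ∧ ∀ θ ∈ Θ, ∀ M : Matrix (Fin n) (Fin n) ℝ,
      ∑ i, ∑ j, M i j ^ 2 ≤ L * Matrix.trace (M * (fisher μ p θ)⁻¹ * M.transpose) := by
  obtain ⟨K, hK⟩ := hp.fisher_bounded
  refine ⟨max 1 (n * K), le_max_left _ _, fun θ hθ M => ?_⟩
  refine sum_sq_le_mul_trace (hp.fisher_posDef θ hθ) (zero_lt_one.trans_le (le_max_left _ _))
    (fun v => (dotProduct_mulVec_le_of_abs_le (hK θ hθ) v).trans ?_) M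
  gcongr
  · exact Finset.sum_nonneg fun i _ => mul_self_nonneg _
  · exact le_max_right _ _

end

section

/-! ### The Cramér–Rao inequality for biased estimators -/

variable {X : Type*} [MeasurableSpace X] {μ : Measure X} {n : ℕ} {Θ : Set (Param n)}
  {p : X → Param n → ℝ} {T : X → Param n}

/-- The Cramér–Rao inequality for a scalar statistic `t` with mean `β` under the density `w`.  The
functions `S j` are the derivatives of the density, so that the scores are `S j / w`. -/
theorem dotProduct_inv_mulVec_add_sq_le {w t : X → ℝ} {S : Fin n → X → ℝ}
    {J : Matrix (Fin n) (Fin n) ℝ} (hJ : J.PosDef) {β : ℝ} {m : Fin n → ℝ}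
    (hw0 : ∀ x, 0 ≤ w x) (hSw : ∀ j x, w x = 0 → S j x = 0)
    (hw : Integrable w μ) (hw1 : ∫ x, w x ∂μ = 1)
    (htw : Integrable (fun x => t x * w x) μ) (hβ : ∫ x, t x * w x ∂μ = β)
    (httw : Integrable (fun x => t x ^ 2 * w x) μ)
    (hS : ∀ j, Integrable (S j) μ) (hS0 : ∀ j, ∫ x, S j x ∂μ = 0)
    (htS : ∀ j, Integrable (fun x => t x * S j x) μ) (hm : ∀ j, ∫ x, t x * S j x ∂μ = m j)
    (hSS : ∀ i j, Integrable (fun x => S i x * S j x / w x) μ)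
    (hJeq : ∀ i j, ∫ x, S i x * S j x / w x ∂μ = J i j) :
    m ⬝ᵥ J⁻¹ *ᵥ m + β ^ 2 ≤ ∫ x, t x ^ 2 * w x ∂μ := by
  have hdet : IsUnit J.det := (Matrix.isUnit_iff_isUnit_det J).1 hJ.isUnit
  -- The best linear predictor of `t - β` from the scores has coefficients `J⁻¹ m`.
  set a : Fin n → ℝ := J⁻¹ *ᵥ m with ha
  have hJa : J *ᵥ a = m := by
    rw [ha, Matrix.mulVec_mulVec, Matrix.mul_nonsing_inv _ hdet, Matrix.one_mulVec]
  set R : X → ℝ := fun x => ∑ j, a j * S j x with hR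
  have hRw : ∀ x, w x = 0 → R x = 0 := fun x hx => by simp [hR, hSw _ x hx]
  have hRint : Integrable R μ := integrable_finsetSum _ fun j _ => (hS j).const_mul _
  have hR0 : ∫ x, R x ∂μ = 0 := by
    rw [hR, integral_finsetSum _ fun j _ => (hS j).const_mul _]
    simp [integral_const_mul, hS0]
  have etR : (fun x => t x * R x) = fun x => ∑ j, a j * (t x * S j x) := by
    ext x; simp only [hR, Finset.mul_sum]; exact Finset.sum_congr rfl fun j _ => by ring
  have htR : Integrable (fun x => t x * R x) μ := by
    rw [etR]; exact integrable_finsetSum _ fun j _ => (htS j).const_mul _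
  have htR' : ∫ x, t x * R x ∂μ = m ⬝ᵥ a := by
    rw [etR, integral_finsetSum _ fun j _ => (htS j).const_mul _]
    simp only [integral_const_mul, hm, dotProduct]
    exact Finset.sum_congr rfl fun j _ => mul_comm _ _
  have eRR : (fun x => R x ^ 2 / w x) = fun x => ∑ i, ∑ j, a i * a j * (S i x * S j x / w x) := by
    ext x
    simp only [hR, sq, Finset.sum_mul_sum, Finset.sum_div]
    exact Finset.sum_congr rfl fun i _ => Finset.sum_congr rfl fun j _ => by ring
  have hRR : Integrable (fun x => R x ^ 2 / w x) μ := by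
    rw [eRR]
    exact integrable_finsetSum _ fun i _ => integrable_finsetSum _ fun j _ =>
      (hSS i j).const_mul _
  have hRR' : ∫ x, R x ^ 2 / w x ∂μ = m ⬝ᵥ a := by
    rw [eRR, integral_finsetSum _ fun i _ => integrable_finsetSum _ fun j _ =>
      (hSS i j).const_mul _]
    simp_rw [integral_finsetSum _ fun j _ => (hSS _ j).const_mul _, integral_const_mul, hJeq]
    rw [dotProduct_comm, ← hJa]
    simp only [dotProduct, Matrix.mulVec, Finset.mul_sum, mul_assoc]
    exact Finset.sum_congr rfl fun i _ => Finset.sum_congr rfl fun j _ => by ring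
  have hexp : ∀ x, (t x - β - R x / w x) ^ 2 * w x = t x ^ 2 * w x - 2 * β * (t x * w x) +
      β ^ 2 * w x - 2 * (t x * R x) + 2 * β * R x + R x ^ 2 / w x := fun x => by
    by_cases h : w x = 0
    · simp [h, hRw x h]
    · field_simp
      ring
  have h0 : 0 ≤ ∫ x, (t x - β - R x / w x) ^ 2 * w x ∂μ :=
    integral_nonneg fun x => mul_nonneg (sq_nonneg _) (hw0 x)
  simp_rw [hexp] at h0
  have i1 : Integrable (fun x => t x ^ 2 * w x - 2 * β * (t x * w x)) μ :=
    httw.sub (htw.const_mul (2 * β))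
  have i2 : Integrable (fun x => t x ^ 2 * w x - 2 * β * (t x * w x) + β ^ 2 * w x) μ :=
    i1.add (hw.const_mul (β ^ 2))
  have i3 : Integrable (fun x => t x ^ 2 * w x - 2 * β * (t x * w x) + β ^ 2 * w x -
      2 * (t x * R x)) μ := i2.sub (htR.const_mul 2)
  have i4 : Integrable (fun x => t x ^ 2 * w x - 2 * β * (t x * w x) + β ^ 2 * w x -
      2 * (t x * R x) + 2 * β * R x) μ := i3.add (hRint.const_mul (2 * β))
  have e : ∫ x, (t x ^ 2 * w x - 2 * β * (t x * w x) +
      β ^ 2 * w x - 2 * (t x * R x) + 2 * β * R x + R x ^ 2 / w x) ∂μ =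
      (∫ x, t x ^ 2 * w x ∂μ) - 2 * β * β + β ^ 2 * 1 - 2 * (m ⬝ᵥ a) + 2 * β * 0 + m ⬝ᵥ a := by
    rw [integral_add i4 hRR, integral_add i3 (hRint.const_mul (2 * β)),
      integral_sub i2 (htR.const_mul 2), integral_add i1 (hw.const_mul (β ^ 2)),
      integral_sub httw (htw.const_mul (2 * β))]
    simp only [integral_const_mul, hβ, hw1, htR', hR0, hRR']
  rw [e] at h0
  linarith

theorem fderiv_eq_sum_partialD (f : Param n → ℝ) (θ : Param n) :
    fderiv ℝ f θ = ∑ j, partialD f j θ • (EuclideanSpace.proj j : Param n →L[ℝ] ℝ) := by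
  ext v
  have hv : v = ∑ j, v j • EuclideanSpace.single j (1 : ℝ) := by
    ext k
    simp [Pi.single_apply]
  conv_lhs => rw [hv]
  simp [partialD, mul_comm]

theorem norm_fderiv_le_sum (f : Param n → ℝ) (θ : Param n) :
    ‖fderiv ℝ f θ‖ ≤ ∑ j, |partialD f j θ| := by
  rw [fderiv_eq_sum_partialD]
  refine (norm_sum_le _ _).trans (Finset.sum_le_sum fun j _ => ?_)
  rw [norm_smul, Real.norm_eq_abs]
  refine mul_le_of_le_one_right (abs_nonneg _) ?_
  exact ContinuousLinearMap.opNorm_le_bound _ zero_le_one fun v => by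
    rw [one_mul]; exact PiLp.norm_apply_le v j

theorem IsEstimator.exists_bound (hT : IsEstimator μ Θ p T) :
    ∃ g : X → ℝ, Integrable g μ ∧ ∀ᵐ x ∂μ, ∀ θ ∈ Θ, ∀ i, ‖T x i • fderiv ℝ (p x) θ‖ ≤ g x := by
  obtain ⟨-, g, hg, hTg⟩ := hT
  refine ⟨fun x => n * g x, hg.const_mul _, ?_⟩
  filter_upwards [hTg] with x hx θ hθ i
  have h1 : ∀ j, |partialD (p x) j θ * T x i| ≤ g x := fun j => by
    refine le_trans ?_ (hx θ hθ)
    rw [← Real.sqrt_sq_eq_abs]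
    refine Real.sqrt_le_sqrt ?_
    refine le_trans ?_ (Finset.single_le_sum
      (f := fun j => ∑ i, (partialD (p x) j θ * T x i) ^ 2)
      (fun j _ => Finset.sum_nonneg fun i _ => sq_nonneg _) (Finset.mem_univ j))
    exact Finset.single_le_sum (f := fun i => (partialD (p x) j θ * T x i) ^ 2)
      (fun i _ => sq_nonneg _) (Finset.mem_univ i)
  calc ‖T x i • fderiv ℝ (p x) θ‖ ≤ |T x i| * ∑ j, |partialD (p x) j θ| := by
        rw [norm_smul, Real.norm_eq_abs]; gcongr; exact norm_fderiv_le_sum _ _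
    _ = ∑ j, |partialD (p x) j θ * T x i| := by
        rw [Finset.mul_sum]; exact Finset.sum_congr rfl fun j _ => by rw [abs_mul, mul_comm]
    _ ≤ ∑ _j : Fin n, g x := Finset.sum_le_sum fun j _ => h1 j
    _ = n * g x := by simp

theorem IsEstimator.measurable_apply (hT : IsEstimator μ Θ p T) (i : Fin n) :
    Measurable fun x => T x i :=
  (EuclideanSpace.proj (𝕜 := ℝ) i).measurable.comp hT.1

theorem IsRegularModel.aestronglyMeasurable_smul_fderiv (hp : IsRegularModel μ Θ p)
    (hΘ : IsOpen Θ) (hT : IsEstimator μ Θ p T) {θ : Param n} (hθ : θ ∈ Θ) (i : Fin n) :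
    AEStronglyMeasurable (fun x => T x i • fderiv ℝ (p x) θ) μ := by
  simp only [fderiv_eq_sum_partialD (p _) θ]
  exact (hT.measurable_apply i).aestronglyMeasurable.smul
    (Finset.aestronglyMeasurable_fun_sum _ fun j _ =>
      (hp.measurable_partialD hΘ hθ j).aestronglyMeasurable.smul_const _)

theorem IsRegularModel.integrable (hp : IsRegularModel μ Θ p) {θ : Param n} (hθ : θ ∈ Θ) :
    Integrable (fun x => p x θ) μ := by
  refine ⟨(hp.measurable θ hθ).aestronglyMeasurable, ?_⟩
  rw [hasFiniteIntegral_iff_ofReal (ae_of_all _ fun x => hp.nonneg x θ hθ), hp.mass θ hθ]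
  exact ENNReal.one_lt_top

theorem IsRegularModel.integral_eq_one (hp : IsRegularModel μ Θ p) {θ : Param n} (hθ : θ ∈ Θ) :
    ∫ x, p x θ ∂μ = 1 := by
  rw [integral_eq_lintegral_of_nonneg_ae (ae_of_all _ fun x => hp.nonneg x θ hθ)
    (hp.measurable θ hθ).aestronglyMeasurable, hp.mass θ hθ, ENNReal.toReal_one]

theorem IsRegularModel.integral_partialD (hp : IsRegularModel μ Θ p) (hΘ : IsOpen Θ)
    {θ : Param n} (hθ : θ ∈ Θ) (j : Fin n) : ∫ x, partialD (p x) j θ ∂μ = 0 := by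
  rw [(hp.exchange θ hθ j).2]
  have : (fun ϑ => ∫ x, p x ϑ ∂μ) =ᶠ[𝓝 θ] fun _ => (1 : ℝ) := by
    filter_upwards [hΘ.mem_nhds hθ] with ϑ hϑ using hp.integral_eq_one hϑ
  rw [partialD, this.fderiv_eq]
  simp

/-- The mean-squared error of `T` at the parameter `θ`. -/
noncomputable def condMSE (μ : Measure X) (p : X → Param n → ℝ) (T : X → Param n) (θ : Param n) : ℝ≥0∞ :=
  ∫⁻ x, ENNReal.ofReal (‖T x - θ‖ ^ 2) * ENNReal.ofReal (p x θ) ∂μ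

theorem integrable_sq_norm_mul_of_condMSE_lt_top (hp : IsRegularModel μ Θ p) (hT : Measurable T)
    {θ : Param n} (hθ : θ ∈ Θ) (h : condMSE μ p T θ < ⊤) :
    Integrable (fun x => ‖T x - θ‖ ^ 2 * p x θ) μ := by
  refine ⟨(((hT.sub_const θ).norm.pow_const 2).mul (hp.measurable θ hθ)).aestronglyMeasurable, ?_⟩
  rw [hasFiniteIntegral_iff_ofReal (ae_of_all _ fun x =>
    mul_nonneg (sq_nonneg _) (hp.nonneg x θ hθ))]
  simpa only [condMSE, ENNReal.ofReal_mul (sq_nonneg _)] using h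

theorem integrable_mul_of_condMSE_lt_top (hp : IsRegularModel μ Θ p) (hT : IsEstimator μ Θ p T)
    {θ : Param n} (hθ : θ ∈ Θ) (h : condMSE μ p T θ < ⊤) (i : Fin n) :
    Integrable (fun x => T x i * p x θ) μ := by
  refine Integrable.mono' ((integrable_sq_norm_mul_of_condMSE_lt_top hp hT.1 hθ h).add
    ((hp.integrable hθ).const_mul (1 + |θ i|)))
    ((hT.measurable_apply i).mul (hp.measurable θ hθ)).aestronglyMeasurable
    (ae_of_all _ fun x => ?_)
  have hpx := hp.nonneg x θ hθ
  rw [norm_mul, Real.norm_eq_abs, Real.norm_of_nonneg hpx, Pi.add_apply, ← add_mul]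
  refine mul_le_mul_of_nonneg_right ?_ hpx
  have h1 : |T x i - θ i| ≤ ‖T x - θ‖ := PiLp.norm_apply_le (T x - θ) i
  have h2 : |T x i| ≤ |T x i - θ i| + |θ i| := by
    simpa using abs_add_le (T x i - θ i) (θ i)
  nlinarith [sq_nonneg (‖T x - θ‖ - 1)]

/-- A finite Bayesian error leaves points of finite mean-squared error in every nonempty open subset
of `Θ`.  No measurability of the mean-squared error in `θ` is needed. -/
theorem exists_condMSE_lt_top {q : Param n → ℝ} (hq : IsPrior Θ q)
    (hfin : bayesMSE μ Θ q p T < ⊤) {U : Set (Param n)} (hU : IsOpen U) (hne : U.Nonempty)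
    (hUΘ : U ⊆ Θ) : ∃ θ ∈ U, condMSE μ p T θ < ⊤ := by
  by_contra! hcon
  refine hfin.not_ge ?_
  calc ⊤ = ⊤ * volume U := (ENNReal.top_mul (hU.measure_pos volume hne).ne').symm
    _ = ∫⁻ _ in U, ⊤ := by rw [setLIntegral_const]
    _ = ∫⁻ θ in U, condMSE μ p T θ * ENNReal.ofReal (q θ) := by
        refine setLIntegral_congr_fun hU.measurableSet fun θ hθ => ?_
        rw [top_le_iff.1 (hcon θ hθ), ENNReal.top_mul]
        simpa using hq.pos θ (hUΘ hθ)
    _ ≤ bayesMSE μ Θ q p T := lintegral_mono_set hUΘ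

/-- An estimator with finite Bayesian error has a mean at every parameter: at some parameter
nearby it has one, and the domination bounds the change from there. -/
theorem IsEstimator.integrable_mul {q : Param n → ℝ} (hq : IsPrior Θ q)
    (hp : IsRegularModel μ Θ p) (hT : IsEstimator μ Θ p T) (hfin : bayesMSE μ Θ q p T < ⊤)
    {θ : Param n} (hθ : θ ∈ Θ) (i : Fin n) : Integrable (fun x => T x i * p x θ) μ := by
  obtain ⟨r, hr, hball⟩ := Metric.isOpen_iff.1 hq.isOpen θ hθ
  obtain ⟨θ', hθ', hmse⟩ := exists_condMSE_lt_top hq hfin Metric.isOpen_ball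
    (Metric.nonempty_ball.2 hr) hball
  have h' := integrable_mul_of_condMSE_lt_top hp hT (hball hθ') hmse i
  obtain ⟨g, hg, hTg⟩ := hT.exists_bound
  have hdiff : Integrable (fun x => T x i * p x θ - T x i * p x θ') μ := by
    refine Integrable.mono' (hg.mul_const ‖θ - θ'‖)
      (((hT.measurable_apply i).mul (hp.measurable θ hθ)).sub
        ((hT.measurable_apply i).mul (hp.measurable θ' (hball hθ')))).aestronglyMeasurable ?_
    filter_upwards [hTg] with x hx
    exact (convex_ball θ r).norm_image_sub_le_of_norm_hasFDerivWithin_le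
      (f := fun ϑ => T x i * p x ϑ) (f' := fun ϑ => T x i • fderiv ℝ (p x) ϑ)
      (fun ϑ hϑ => ((hp.differentiableAt hq.isOpen x
        (hball hϑ)).hasFDerivAt.const_mul (T x i)).hasFDerivWithinAt)
      (fun ϑ hϑ => hx ϑ (hball hϑ) i) hθ' (Metric.mem_ball_self hr)
  refine (hdiff.add h').congr (ae_of_all _ fun x => ?_)
  simp

theorem IsEstimator.hasFDerivAt_mean {q : Param n → ℝ} (hq : IsPrior Θ q)
    (hp : IsRegularModel μ Θ p) (hT : IsEstimator μ Θ p T) (hfin : bayesMSE μ Θ q p T < ⊤)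
    {θ : Param n} (hθ : θ ∈ Θ) (i : Fin n) :
    HasFDerivAt (fun ϑ => ∫ x, T x i * p x ϑ ∂μ) (∫ x, T x i • fderiv ℝ (p x) θ ∂μ) θ := by
  obtain ⟨g, hg, hTg⟩ := hT.exists_bound
  refine hasFDerivAt_integral_of_dominated_of_fderiv_le (hq.isOpen.mem_nhds hθ)
    (F := fun ϑ x => T x i * p x ϑ) (F' := fun ϑ x => T x i • fderiv ℝ (p x) ϑ) ?_
    (hT.integrable_mul hq hp hfin hθ i) (hp.aestronglyMeasurable_smul_fderiv hq.isOpen hT hθ i)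
    (hTg.mono fun x hx ϑ hϑ => hx ϑ hϑ i) hg
    (ae_of_all _ fun x ϑ hϑ => (hp.differentiableAt hq.isOpen x hϑ).hasFDerivAt.const_mul _)
  filter_upwards [hq.isOpen.mem_nhds hθ] with ϑ hϑ
  exact ((hT.measurable_apply i).mul (hp.measurable ϑ hϑ)).aestronglyMeasurable

theorem IsEstimator.contDiffOn_mean {q : Param n → ℝ} (hq : IsPrior Θ q)
    (hp : IsRegularModel μ Θ p) (hT : IsEstimator μ Θ p T) (hfin : bayesMSE μ Θ q p T < ⊤)
    (i : Fin n) : ContDiffOn ℝ 1 (fun ϑ => ∫ x, T x i * p x ϑ ∂μ) Θ := by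
  obtain ⟨g, hg, hTg⟩ := hT.exists_bound
  rw [show (1 : WithTop ℕ∞) = 0 + 1 by rw [zero_add],
    contDiffOn_succ_iff_fderiv_of_isOpen hq.isOpen, contDiffOn_zero]
  refine ⟨fun θ hθ => (hT.hasFDerivAt_mean hq hp hfin hθ i).differentiableAt.differentiableWithinAt,
    by simp, ?_⟩
  refine ContinuousOn.congr (f := fun θ => ∫ x, T x i • fderiv ℝ (p x) θ ∂μ) ?_
    fun θ hθ => (hT.hasFDerivAt_mean hq hp hfin hθ i).fderiv
  refine continuousOn_of_dominated
    (fun θ hθ => hp.aestronglyMeasurable_smul_fderiv hq.isOpen hT hθ i)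
    (fun θ hθ => hTg.mono fun x hx => hx θ hθ i) hg
    (ae_of_all _ fun x => (hp.continuousOn_fderiv hq.isOpen x).const_smul (T x i))

/-- The bias of an estimator as a function of the parameter. -/
noncomputable def bias (μ : Measure X) (p : X → Param n → ℝ) (T : X → Param n) (θ : Param n) : Param n :=
  WithLp.toLp 2 fun i => ∫ x, T x i * p x θ ∂μ - θ i

theorem IsEstimator.contDiffOn_bias {q : Param n → ℝ} (hq : IsPrior Θ q)
    (hp : IsRegularModel μ Θ p) (hT : IsEstimator μ Θ p T) (hfin : bayesMSE μ Θ q p T < ⊤)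
    (i : Fin n) : ContDiffOn ℝ 1 (fun θ => bias μ p T θ i) Θ :=
  (hT.contDiffOn_mean hq hp hfin i).sub
    (EuclideanSpace.proj i : Param n →L[ℝ] ℝ).contDiff.contDiffOn

theorem IsEstimator.integrable_smul_fderiv (hp : IsRegularModel μ Θ p) (hΘ : IsOpen Θ)
    (hT : IsEstimator μ Θ p T) {θ : Param n} (hθ : θ ∈ Θ) (i : Fin n) :
    Integrable (fun x => T x i • fderiv ℝ (p x) θ) μ := by
  obtain ⟨g, hg, hTg⟩ := hT.exists_bound
  exact Integrable.mono' hg (hp.aestronglyMeasurable_smul_fderiv hΘ hT hθ i)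
    (hTg.mono fun x hx => hx θ hθ i)

/-- Adding the identity to the derivative of the bias gives the derivative of the mean. -/
theorem IsEstimator.one_add_partialD_bias {q : Param n → ℝ} (hq : IsPrior Θ q)
    (hp : IsRegularModel μ Θ p) (hT : IsEstimator μ Θ p T) (hfin : bayesMSE μ Θ q p T < ⊤)
    {θ : Param n} (hθ : θ ∈ Θ) :
    (1 + Matrix.of fun i j => partialD (fun ϑ => bias μ p T ϑ i) j θ :
      Matrix (Fin n) (Fin n) ℝ) = Matrix.of fun i j => ∫ x, T x i * partialD (p x) j θ ∂μ := by
  ext i j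
  have h := (hT.hasFDerivAt_mean hq hp hfin hθ i).sub
    (EuclideanSpace.proj i : Param n →L[ℝ] ℝ).hasFDerivAt
  have h2 : partialD (fun ϑ => bias μ p T ϑ i) j θ =
      ((∫ x, T x i • fderiv ℝ (p x) θ ∂μ) - EuclideanSpace.proj i : Param n →L[ℝ] ℝ)
        (EuclideanSpace.single j (1 : ℝ)) := by
    rw [partialD]; exact congrArg (fun L => L (EuclideanSpace.single j (1 : ℝ))) h.fderiv
  rw [Matrix.add_apply, Matrix.of_apply, Matrix.of_apply, h2, _root_.sub_apply,
    ContinuousLinearMap.integral_apply (hT.integrable_smul_fderiv hp hq.isOpen hθ i)]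
  have h3 : (EuclideanSpace.proj i : Param n →L[ℝ] ℝ) (EuclideanSpace.single j (1 : ℝ)) =
      (1 : Matrix (Fin n) (Fin n) ℝ) i j := by
    simp [Matrix.one_apply]
  rw [h3, add_sub_cancel]
  rfl

/-- The Cramér–Rao inequality at a fixed parameter. -/
theorem IsEstimator.crb_bias_le {q : Param n → ℝ} (hq : IsPrior Θ q)
    (hp : IsRegularModel μ Θ p) (hT : IsEstimator μ Θ p T) (hfin : bayesMSE μ Θ q p T < ⊤)
    {θ : Param n} (hθ : θ ∈ Θ) :
    ENNReal.ofReal (crb μ p (bias μ p T)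
      (fun θ => Matrix.of fun i j => partialD (fun ϑ => bias μ p T ϑ i) j θ) θ) ≤
      condMSE μ p T θ := by
  rcases eq_or_ne (condMSE μ p T θ) ⊤ with htop | htop
  · rw [htop]; exact le_top
  have hsq := integrable_sq_norm_mul_of_condMSE_lt_top hp hT.1 hθ (lt_top_iff_ne_top.2 htop)
  have hval : condMSE μ p T θ = ENNReal.ofReal (∫ x, ‖T x - θ‖ ^ 2 * p x θ ∂μ) := by
    rw [ofReal_integral_eq_lintegral_ofReal hsq (ae_of_all _ fun x =>
      mul_nonneg (sq_nonneg _) (hp.nonneg x θ hθ))]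
    simp only [condMSE, ENNReal.ofReal_mul (sq_nonneg _)]
  rw [hval]
  refine ENNReal.ofReal_le_ofReal ?_
  have hcoord : ∀ i, Integrable (fun x => (T x i - θ i) ^ 2 * p x θ) μ := fun i => by
    refine hsq.mono' ((((hT.measurable_apply i).sub_const _).pow_const 2).mul
      (hp.measurable θ hθ)).aestronglyMeasurable (ae_of_all _ fun x => ?_)
    have hpx := hp.nonneg x θ hθ
    rw [Real.norm_of_nonneg (mul_nonneg (sq_nonneg _) hpx)]
    refine mul_le_mul_of_nonneg_right ?_ hpx
    have h1 : |T x i - θ i| ≤ ‖T x - θ‖ := PiLp.norm_apply_le (T x - θ) i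
    rw [← sq_abs]
    gcongr
  have hsum : ∫ x, ‖T x - θ‖ ^ 2 * p x θ ∂μ = ∑ i, ∫ x, (T x i - θ i) ^ 2 * p x θ ∂μ := by
    rw [← integral_finsetSum _ fun i _ => hcoord i]
    congr 1; ext x
    simp only [EuclideanSpace.norm_sq_eq, Finset.sum_mul, Real.norm_eq_abs, sq_abs,
      PiLp.sub_apply]
  rw [crb, hT.one_add_partialD_bias hq hp hfin hθ, trace_mul_mul_transpose,
    EuclideanSpace.norm_sq_eq, ← Finset.sum_add_distrib, hsum]
  refine Finset.sum_le_sum fun i _ => ?_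
  rw [Real.norm_eq_abs, sq_abs]
  have hTp := hT.integrable_mul hq hp hfin hθ i
  have hTS : ∀ j, Integrable (fun x => T x i * partialD (p x) j θ) μ := fun j =>
    (hT.integrable_smul_fderiv hp hq.isOpen hθ i).apply_continuousLinearMap _
  have hS := fun j => (hp.exchange θ hθ j).1
  refine dotProduct_inv_mulVec_add_sq_le (w := fun x => p x θ) (t := fun x => T x i - θ i)
    (S := fun j x => partialD (p x) j θ) (hp.fisher_posDef θ hθ)
    (fun x => hp.nonneg x θ hθ) (fun j x h => hp.partialD_eq_zero hq.isOpen hθ h j)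
    (hp.integrable hθ) (hp.integral_eq_one hθ) ?_ ?_ (hcoord i) hS
    (hp.integral_partialD hq.isOpen hθ) (fun j => ?_) (fun j => ?_) (fun k j => ?_) fun k j => ?_
  · simp only [sub_mul]; exact hTp.sub ((hp.integrable hθ).const_mul (θ i))
  · simp only [sub_mul]
    rw [integral_sub hTp ((hp.integrable hθ).const_mul (θ i)), integral_const_mul,
      hp.integral_eq_one hθ, mul_one]
    rfl
  · simp only [sub_mul]; exact (hTS j).sub ((hS j).const_mul (θ i))
  · simp only [sub_mul]
    rw [integral_sub (hTS j) ((hS j).const_mul (θ i)), integral_const_mul,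
      hp.integral_partialD hq.isOpen hθ, mul_zero, sub_zero]
    rfl
  · simpa only [hp.fisher_integrand_eq hq.isOpen hθ] using hp.fisher_integrable θ hθ k j
  · exact (hp.fisher_apply hq.isOpen hθ k j).symm

end

section

/-! ### The bound as a functional on jets -/

variable {X : Type*} [MeasurableSpace X] {μ : Measure X} {n : ℕ} {Θ : Set (Param n)}
  {q : Param n → ℝ} {p : X → Param n → ℝ}

/-- The Cramér–Rao bound at `θ` as a function of the value and the derivative of the bias. -/
noncomputable def jetCRB (μ : Measure X) (p : X → Param n → ℝ) (θ : Param n) (z : Jet n) : ℝ :=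
  Matrix.trace ((1 + Matrix.of z.2) * (fisher μ p θ)⁻¹ * (1 + Matrix.of z.2).transpose) +
    ‖z.1‖ ^ 2

/-- The function `b` together with the matrix-valued function `D`. -/
def jet (b : Param n → Param n) (D : Param n → Matrix (Fin n) (Fin n) ℝ) : Param n → Jet n :=
  fun θ => (b θ, fun i j => D θ i j)

/-- The pairs of a function and its distributional derivative, both square integrable under the
prior. -/
def jetSpace (Θ : Set (Param n)) (q : Param n → ℝ) : Set (Param n → Jet n) :=
  {u | MemLp u 2 (priorMeasure Θ q) ∧ IsWeakDeriv Θ (fun θ => (u θ).1) fun θ => Matrix.of (u θ).2}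

theorem memLp_jet_iff {π : Measure (Param n)} {u : Param n → Jet n} :
    MemLp u 2 π ↔ MemLp (fun θ => (u θ).1) 2 π ∧ ∀ i j, MemLp (fun θ => (u θ).2 i j) 2 π := by
  rw [memLp_prod_iff, memLp_pi_iff]
  simp only [memLp_pi_iff]

theorem jet_mem_jetSpace {b : Param n → Param n} (hb : b ∈ H1 Θ q) :
    jet b (weakDeriv Θ b) ∈ jetSpace Θ q :=
  ⟨memLp_jet_iff.2 ⟨hb.1, hb.2.2⟩, isWeakDeriv_weakDeriv hb.2.1⟩

theorem fst_mem_H1 (hΘ : IsOpen Θ) {u : Param n → Jet n} (hu : u ∈ jetSpace Θ q) :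
    (fun θ => (u θ).1) ∈ H1 Θ q := by
  have hu' := memLp_jet_iff.1 hu.1
  refine ⟨hu'.1, ⟨_, hu.2⟩, fun i j => (memLp_congr_ae ?_).2 (hu'.2 i j)⟩
  filter_upwards [prior_absolutelyContinuous_restrict.ae_le (hu.2.weakDeriv_ae_eq hΘ)] with θ hθ
  rw [hθ]; rfl

theorem avgCRB_eq_lintegral (hq : IsPrior Θ q) (b : Param n → Param n) :
    avgCRB μ Θ q p b =
      ∫⁻ θ, ENNReal.ofReal (jetCRB μ p θ (jet b (weakDeriv Θ b) θ)) ∂priorMeasure Θ q := by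
  rw [lintegral_priorMeasure hq]; rfl

theorem avgCRB_fst (hq : IsPrior Θ q) {u : Param n → Jet n} (hu : u ∈ jetSpace Θ q) :
    avgCRB μ Θ q p (fun θ => (u θ).1) =
      ∫⁻ θ, ENNReal.ofReal (jetCRB μ p θ (u θ)) ∂priorMeasure Θ q := by
  rw [avgCRB_eq_lintegral hq]
  refine lintegral_congr_ae ?_
  filter_upwards [prior_absolutelyContinuous_restrict.ae_le (hu.2.weakDeriv_ae_eq hq.isOpen)] with θ hθ
  simp only [jet, hθ]; rfl

theorem ae_mem_prior (hq : IsPrior Θ q) : ∀ᵐ θ ∂priorMeasure Θ q, θ ∈ Θ :=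
  prior_absolutelyContinuous_restrict.ae_le (ae_restrict_mem hq.isOpen.measurableSet)

theorem aemeasurable_jetCRB [SigmaFinite μ] (hq : IsPrior Θ q) (hp : IsRegularModel μ Θ p)
    {u : Param n → Jet n} (hb : AEMeasurable (fun θ => (u θ).1) (priorMeasure Θ q))
    (hD : ∀ i j, AEMeasurable (fun θ => (u θ).2 i j) (priorMeasure Θ q)) :
    AEMeasurable (fun θ => jetCRB μ p θ (u θ)) (priorMeasure Θ q) := by
  refine (aemeasurable_trace_mul_inv
    (fun i j => (hp.aemeasurable_fisher hq.isOpen i j).mono_ac prior_absolutelyContinuous_restrict)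
    fun i j => ?_).add (hb.norm.pow_const 2)
  simp only [Matrix.add_apply, Matrix.of_apply]
  exact aemeasurable_const.add (hD i j)

theorem continuous_jetCRB (θ : Param n) : Continuous (jetCRB μ p θ) := by
  unfold jetCRB
  simp only [trace_mul_mul_transpose, dotProduct, Matrix.mulVec, Matrix.add_apply,
    Matrix.of_apply]
  fun_prop

/-- The parallelogram identity for the Cramér–Rao bound. -/
theorem two_mul_jetCRB_midpoint_add (θ : Param n) (y z : Jet n) :
    2 * jetCRB μ p θ ((1 / 2 : ℝ) • (y + z)) +
      1 / 2 * (Matrix.trace (Matrix.of (y - z).2 * (fisher μ p θ)⁻¹ *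
        (Matrix.of (y - z).2).transpose) + ‖(y - z).1‖ ^ 2) =
      jetCRB μ p θ y + jetCRB μ p θ z := by
  have h1 := trace_parallelogram (fisher μ p θ)⁻¹ (1 + Matrix.of y.2) (1 + Matrix.of z.2)
  have e1 : (1 / 2 : ℝ) • ((1 + Matrix.of y.2) + (1 + Matrix.of z.2)) =
      1 + Matrix.of ((1 / 2 : ℝ) • (y + z)).2 := by
    ext i j
    simp only [Matrix.smul_apply, Matrix.add_apply, Matrix.of_apply, Prod.smul_snd, Prod.snd_add,
      Pi.smul_apply, Pi.add_apply, smul_eq_mul]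
    ring
  have e2 : (1 + Matrix.of y.2) - (1 + Matrix.of z.2) = Matrix.of (y - z).2 := by
    rw [add_sub_add_left_eq_sub]; rfl
  rw [e1, e2] at h1
  have h2 := parallelogram_law_with_norm ℝ y.1 z.1
  have h3 : ‖((1 / 2 : ℝ) • (y + z)).1‖ = 1 / 2 * ‖y.1 + z.1‖ := by
    rw [Prod.smul_fst, Prod.fst_add, norm_smul]; norm_num
  rw [jetCRB, jetCRB, jetCRB, h3, Prod.fst_sub]
  nlinarith

theorem sq_norm_le_of_coercive {J : Matrix (Fin n) (Fin n) ℝ} (hJ : J.PosDef) {L : ℝ}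
    (hL : 1 ≤ L) (h : ∀ M : Matrix (Fin n) (Fin n) ℝ,
      ∑ i, ∑ j, M i j ^ 2 ≤ L * Matrix.trace (M * J⁻¹ * M.transpose)) (z : Jet n) :
    ‖z‖ ^ 2 ≤ L * (Matrix.trace (Matrix.of z.2 * J⁻¹ * (Matrix.of z.2).transpose) +
      ‖z.1‖ ^ 2) := by
  set τ := Matrix.trace (Matrix.of z.2 * J⁻¹ * (Matrix.of z.2).transpose)
  have hτ : 0 ≤ τ := trace_mul_inv_mul_transpose_nonneg hJ _
  have h1 : ∑ i, ∑ j, z.2 i j ^ 2 ≤ L * τ := h (Matrix.of z.2)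
  have hsq := sq_nonneg ‖z.1‖
  have hB : 0 ≤ L * (τ + ‖z.1‖ ^ 2) := by positivity
  rw [← Real.le_sqrt (norm_nonneg _) hB, Prod.norm_def]
  refine max_le (Real.le_sqrt_of_sq_le (by nlinarith)) ?_
  refine (pi_norm_le_iff_of_nonneg (Real.sqrt_nonneg _)).2 fun i =>
    (pi_norm_le_iff_of_nonneg (Real.sqrt_nonneg _)).2 fun j => Real.le_sqrt_of_sq_le ?_
  have h2 : z.2 i j ^ 2 ≤ ∑ i, ∑ j, z.2 i j ^ 2 :=
    (Finset.single_le_sum (f := fun j => z.2 i j ^ 2) (fun j _ => sq_nonneg _)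
      (Finset.mem_univ j)).trans (Finset.single_le_sum (f := fun i => ∑ j, z.2 i j ^ 2)
        (fun i _ => Finset.sum_nonneg fun j _ => sq_nonneg _) (Finset.mem_univ i))
  rw [Real.norm_eq_abs, sq_abs]
  nlinarith

theorem jetCRB_nonneg (hp : IsRegularModel μ Θ p) {θ : Param n} (hθ : θ ∈ Θ) (z : Jet n) :
    0 ≤ jetCRB μ p θ z :=
  add_nonneg (trace_mul_inv_mul_transpose_nonneg (hp.fisher_posDef θ hθ) _) (sq_nonneg _)

theorem IsRegularModel.exists_jetCRB_coercive (hp : IsRegularModel μ Θ p) :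
    ∃ L : ℝ, 1 ≤ L ∧ (∀ θ ∈ Θ, ∀ z, ‖(z.1, fun i j => (1 + Matrix.of z.2) i j)‖ ^ 2 ≤
      L * jetCRB μ p θ z) ∧ ∀ θ ∈ Θ, ∀ y z : Jet n,
        2 * jetCRB μ p θ ((1 / 2 : ℝ) • (y + z)) + 1 / (2 * L) * ‖y - z‖ ^ 2 ≤
          jetCRB μ p θ y + jetCRB μ p θ z := by
  obtain ⟨L, hL, h⟩ := hp.exists_coercive
  refine ⟨L, hL, fun θ hθ z => ?_, fun θ hθ y z => ?_⟩
  · exact sq_norm_le_of_coercive (hp.fisher_posDef θ hθ) hL (h θ hθ)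
      (z.1, fun i j => (1 + Matrix.of z.2) i j)
  · rw [← two_mul_jetCRB_midpoint_add]
    refine add_le_add le_rfl ?_
    have h1 := sq_norm_le_of_coercive (hp.fisher_posDef θ hθ) hL (h θ hθ) (y - z)
    rw [div_mul_eq_mul_div, one_mul, div_le_iff₀ (by positivity)]
    linarith

/-- A function of finite average bound is square integrable together with its derivative. -/
theorem jet_mem_jetSpace_of_lintegral_ne_top (hq : IsPrior Θ q) (hp : IsRegularModel μ Θ p)
    {b : Param n → Param n} {D : Param n → Matrix (Fin n) (Fin n) ℝ} (hbD : IsWeakDeriv Θ b D)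
    (hfin : ∫⁻ θ in Θ, ENNReal.ofReal (crb μ p b D θ) * ENNReal.ofReal (q θ) ≠ ⊤) :
    jet b D ∈ jetSpace Θ q := by
  have := hq.isProbabilityMeasure
  obtain ⟨L, hL, hcoer, -⟩ := hp.exists_jetCRB_coercive
  have hbm : ∀ i, AEStronglyMeasurable (fun θ => b θ i) (priorMeasure Θ q) := fun i =>
    (hbD.1 i).aestronglyMeasurable.mono_ac prior_absolutelyContinuous_restrict
  have hDm : ∀ i j, AEStronglyMeasurable (fun θ => D θ i j) (priorMeasure Θ q) := fun i j =>
    (hbD.2.1 i j).aestronglyMeasurable.mono_ac prior_absolutelyContinuous_restrict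
  -- Coercivity controls `b` and `1 + D`; the identity is then subtracted, the prior being finite.
  have key : ∀ f : Param n → ℝ, AEStronglyMeasurable f (priorMeasure Θ q) →
      (∀ θ ∈ Θ, |f θ| ≤ ‖((b θ, fun i j => (1 + D θ) i j) : Jet n)‖) →
      MemLp f 2 (priorMeasure Θ q) := by
    intro f hf hle
    refine ⟨hf, ?_⟩
    have h1 : eLpNorm f 2 (priorMeasure Θ q) ^ 2 < ⊤ := by
      calc eLpNorm f 2 (priorMeasure Θ q) ^ 2
          ≤ ∫⁻ θ, ENNReal.ofReal L * ENNReal.ofReal (crb μ p b D θ) ∂priorMeasure Θ q := by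
            rw [eLpNorm_two_sq]
            refine lintegral_mono_ae ?_
            filter_upwards [ae_mem_prior hq] with θ hθ
            rw [← ENNReal.ofReal_mul (by positivity), Real.enorm_eq_ofReal_abs,
              ← ENNReal.ofReal_pow (abs_nonneg _)]
            exact ENNReal.ofReal_le_ofReal
              ((pow_le_pow_left₀ (abs_nonneg _) (hle θ hθ) 2).trans (hcoer θ hθ (jet b D θ)))
        _ = ENNReal.ofReal L *
              ∫⁻ θ in Θ, ENNReal.ofReal (crb μ p b D θ) * ENNReal.ofReal (q θ) := by
            rw [lintegral_const_mul' _ _ ENNReal.ofReal_ne_top, lintegral_priorMeasure hq]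
        _ < ⊤ := ENNReal.mul_lt_top ENNReal.ofReal_lt_top (lt_top_iff_ne_top.2 hfin)
    by_contra hcon
    rw [not_lt, top_le_iff] at hcon
    simp [hcon] at h1
  refine ⟨memLp_jet_iff.2 ⟨memLp_piLp_iff.2 fun i => key _ (hbm i) fun θ _ =>
    (PiLp.norm_apply_le (b θ) i).trans (norm_fst_le (b θ, _)), fun i j => ?_⟩, hbD⟩
  have h1 : MemLp (fun θ => (1 + D θ) i j) 2 (priorMeasure Θ q) := by
    refine key _ ?_ fun θ _ => ?_
    · simp only [Matrix.add_apply]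
      exact aestronglyMeasurable_const.add (hDm i j)
    · exact ((norm_le_pi_norm (fun j => (1 + D θ) i j) j).trans
        (norm_le_pi_norm (fun i j => (1 + D θ) i j) i)).trans
        (norm_snd_le (b θ, fun i j => (1 + D θ) i j))
  refine (h1.sub (memLp_const ((1 : Matrix (Fin n) (Fin n) ℝ) i j))).ae_eq
    (ae_of_all _ fun θ => ?_)
  simp [jet]

/-- Some function has finite average bound: the zero function when the averaged unbiased bound is
finite, and `b θ = -θ`, whose derivative cancels the identity, when the prior has a second
moment. -/
theorem exists_jet_lintegral_ne_top (hq : IsPrior Θ q) (hp : IsRegularModel μ Θ p)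
    (hfin : ∫⁻ θ in Θ, ENNReal.ofReal (Matrix.trace (fisher μ p θ)⁻¹) *
        ENNReal.ofReal (q θ) < ⊤ ∨
      ∫⁻ θ in Θ, ENNReal.ofReal (‖θ‖ ^ 2) * ENNReal.ofReal (q θ) < ⊤) :
    ∃ u ∈ jetSpace Θ q, ∫⁻ θ, ENNReal.ofReal (jetCRB μ p θ (u θ)) ∂priorMeasure Θ q ≠ ⊤ := by
  -- Both candidates have the form `b θ = c • θ`.
  have main : ∀ c : ℝ, (∫⁻ θ in Θ, ENNReal.ofReal (Matrix.trace
      ((1 + c • 1) * (fisher μ p θ)⁻¹ * (1 + c • 1 : Matrix (Fin n) (Fin n) ℝ).transpose) +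
        ‖c • θ‖ ^ 2) * ENNReal.ofReal (q θ) ≠ ⊤) →
      ∃ u ∈ jetSpace Θ q, ∫⁻ θ, ENNReal.ofReal (jetCRB μ p θ (u θ)) ∂priorMeasure Θ q ≠ ⊤ := by
    intro c hc
    have hw : IsWeakDeriv Θ (fun θ => c • θ) fun _ => (c • 1 : Matrix (Fin n) (Fin n) ℝ) := by
      have hlin : ∀ i, (fun θ : Param n => (c • θ) i) =
          (c • EuclideanSpace.proj i : Param n →L[ℝ] ℝ) := fun i => by ext θ; simp
      have h := isWeakDeriv_of_contDiffOn hq.isOpen (b := fun θ => c • θ) fun i => by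
        rw [hlin i]; exact (ContinuousLinearMap.contDiff _).contDiffOn
      convert h using 3 with θ i j
      ext i j
      rw [Matrix.of_apply, partialD, hlin i, ContinuousLinearMap.fderiv]
      simp [Matrix.one_apply]
    refine ⟨_, jet_mem_jetSpace_of_lintegral_ne_top hq hp hw hc, ?_⟩
    rw [lintegral_priorMeasure hq]
    exact hc
  rcases hfin with h | h
  · refine main 0 ?_
    simpa using h.ne
  · refine main (-1) ?_
    simpa using h.ne

theorem exists_unique_jet_minimizer [SigmaFinite μ] (hq : IsPrior Θ q)
    (hp : IsRegularModel μ Θ p) (hq_inv : LocallyIntegrableOn (fun θ => (q θ)⁻¹) Θ)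
    (hfin : ∃ u ∈ jetSpace Θ q,
      ∫⁻ θ, ENNReal.ofReal (jetCRB μ p θ (u θ)) ∂priorMeasure Θ q ≠ ⊤) :
    ∃ v ∈ jetSpace Θ q, ∫⁻ θ, ENNReal.ofReal (jetCRB μ p θ (v θ)) ∂priorMeasure Θ q ≠ ⊤ ∧
      (∀ u ∈ jetSpace Θ q, ∫⁻ θ, ENNReal.ofReal (jetCRB μ p θ (v θ)) ∂priorMeasure Θ q ≤
        ∫⁻ θ, ENNReal.ofReal (jetCRB μ p θ (u θ)) ∂priorMeasure Θ q) ∧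
      ∀ u ∈ jetSpace Θ q, ∫⁻ θ, ENNReal.ofReal (jetCRB μ p θ (u θ)) ∂priorMeasure Θ q =
        ∫⁻ θ, ENNReal.ofReal (jetCRB μ p θ (v θ)) ∂priorMeasure Θ q →
        u =ᵐ[priorMeasure Θ q] v := by
  obtain ⟨L, hL, -, hconv⟩ := hp.exists_jetCRB_coercive
  have hL0 : 0 < 1 / (2 * L) := by positivity
  refine exists_unique_minimizer (priorMeasure Θ q) (fun θ z => ENNReal.ofReal (jetCRB μ p θ z))
    (jetSpace Θ q) (c := ENNReal.ofReal (1 / (2 * L))) (by simpa using hL0) ENNReal.ofReal_ne_top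
    hfin (fun u hu => hu.1) (fun u hu v hv => ⟨(hu.1.add hv.1).const_smul (1 / 2 : ℝ), ?_⟩)
    (fun u hu v hv huv => ⟨hv, isWeakDeriv_of_tendsto hq hq_inv (fun k => (hu k).1) hv huv
      fun k => (hu k).2⟩) (fun u hu => ?_)
    (ae_of_all _ fun θ => ENNReal.continuous_ofReal.comp (continuous_jetCRB θ)) ?_
  · exact hu.2.midpoint hv.2
  · have h := memLp_jet_iff.1 hu.1
    exact (aemeasurable_jetCRB hq hp h.1.1.aemeasurable
      fun i j => (h.2 i j).1.aemeasurable).ennreal_ofReal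
  · filter_upwards [ae_mem_prior hq] with θ hθ y z
    have h := ENNReal.ofReal_le_ofReal (hconv θ hθ y z)
    rw [ENNReal.ofReal_add (mul_nonneg zero_le_two (jetCRB_nonneg hp hθ _)) (by positivity),
      ENNReal.ofReal_add (jetCRB_nonneg hp hθ _) (jetCRB_nonneg hp hθ _),
      ENNReal.ofReal_mul zero_le_two, ENNReal.ofReal_mul hL0.le,
      ENNReal.ofReal_pow (norm_nonneg _), ofReal_norm] at h
    simpa using h

/-- The average bound never vanishes: a vanishing bias has vanishing derivative, which leaves the
term from the identity. -/
theorem lintegral_jetCRB_ne_zero [SigmaFinite μ] (hn : 1 ≤ n) (hq : IsPrior Θ q)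
    (hp : IsRegularModel μ Θ p) {u : Param n → Jet n} (hu : u ∈ jetSpace Θ q) :
    ∫⁻ θ, ENNReal.ofReal (jetCRB μ p θ (u θ)) ∂priorMeasure Θ q ≠ 0 := by
  intro h0
  have := hq.isProbabilityMeasure
  obtain ⟨L, hL, hcoer, -⟩ := hp.exists_jetCRB_coercive
  have hu' := memLp_jet_iff.1 hu.1
  rw [lintegral_eq_zero_iff' (aemeasurable_jetCRB hq hp hu'.1.1.aemeasurable
      fun i j => (hu'.2 i j).1.aemeasurable).ennreal_ofReal] at h0
  have hz : ∀ᵐ θ ∂priorMeasure Θ q, (u θ).1 = 0 ∧ 1 + Matrix.of (u θ).2 = 0 := by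
    filter_upwards [h0, ae_mem_prior hq] with θ h1 hθ
    have h2 : jetCRB μ p θ (u θ) ≤ 0 := ENNReal.ofReal_eq_zero.1 h1
    have h3 := hcoer θ hθ (u θ)
    have h4 : ‖((u θ).1, fun i j => (1 + Matrix.of (u θ).2) i j)‖ = 0 := by
      refine pow_eq_zero_iff two_ne_zero |>.1 (le_antisymm (h3.trans ?_) (sq_nonneg _))
      exact mul_nonpos_of_nonneg_of_nonpos (by linarith) h2
    have h5 := Prod.ext_iff.1 (norm_eq_zero.1 h4)
    exact ⟨h5.1, h5.2⟩
  have hb : (fun θ => (u θ).1) =ᵐ[volume.restrict Θ] fun _ => 0 :=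
    (restrict_absolutelyContinuous_prior hq).ae_le (hz.mono fun θ h => h.1)
  have hzero : IsWeakDeriv Θ (fun _ : Param n => (0 : Param n)) 0 := by
    refine ⟨fun i => locallyIntegrableOn_zero, fun i j => locallyIntegrableOn_zero, ?_⟩
    intro φ _ _ _ i j
    simp
  have hD := (prior_absolutelyContinuous_restrict (q := q)).ae_le ((hu.2.congr hb .rfl).unique hq.isOpen hzero)
  obtain ⟨θ, h1, h2⟩ := (hz.and hD).exists
  have h3 : (1 : Matrix (Fin n) (Fin n) ℝ) = 0 := by
    have h4 := h1.2
    have h6 : Matrix.of (u θ).2 = 0 := h2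
    rwa [h6, add_zero] at h4
  have h5 := congrFun (congrFun h3 ⟨0, hn⟩) ⟨0, hn⟩
  simp at h5

/-- The witness is the bias of the estimator with its classical derivative. -/
theorem lintegral_jetCRB_le_bayesMSE (hq : IsPrior Θ q) (hp : IsRegularModel μ Θ p)
    {T : X → Param n} (hT : IsEstimator μ Θ p T) (hfin : bayesMSE μ Θ q p T < ⊤) :
    ∃ u ∈ jetSpace Θ q, ∫⁻ θ, ENNReal.ofReal (jetCRB μ p θ (u θ)) ∂priorMeasure Θ q ≤
      bayesMSE μ Θ q p T := by
  have hw := isWeakDeriv_of_contDiffOn hq.isOpen (hT.contDiffOn_bias hq hp hfin)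
  have hle : ∫⁻ θ in Θ, ENNReal.ofReal (crb μ p (bias μ p T)
      (fun θ => Matrix.of fun i j => partialD (fun ϑ => bias μ p T ϑ i) j θ) θ) *
        ENNReal.ofReal (q θ) ≤ bayesMSE μ Θ q p T := by
    refine lintegral_mono_ae ?_
    filter_upwards [ae_restrict_mem hq.isOpen.measurableSet] with θ hθ
    exact mul_le_mul_left (hT.crb_bias_le hq hp hfin hθ) _
  refine ⟨_, jet_mem_jetSpace_of_lintegral_ne_top hq hp hw (hle.trans_lt hfin).ne, ?_⟩
  rw [lintegral_priorMeasure hq]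
  exact hle

end

end OBB

/-- The optimal-bias bound. -/
theorem theorem1 {X : Type*} [MeasurableSpace X] (μ : Measure X) [SigmaFinite μ]
    (n : ℕ) (hn : 1 ≤ n) (Θ : Set (OBB.Param n)) (q : OBB.Param n → ℝ)
    (p : X → OBB.Param n → ℝ)
    (hq : OBB.IsPrior Θ q)
    (hp : OBB.IsRegularModel μ Θ p)
    -- functions that are square integrable under the prior have distributional derivatives
    (hq_inv : LocallyIntegrableOn (fun θ => (q θ)⁻¹) Θ)
    -- the averaged unbiased Cramér–Rao bound or the second moment of the prior is finite
    (hfin : ∫⁻ θ in Θ, ENNReal.ofReal (Matrix.trace (OBB.fisher μ p θ)⁻¹) *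
        ENNReal.ofReal (q θ) < ⊤ ∨
      ∫⁻ θ in Θ, ENNReal.ofReal (‖θ‖ ^ 2) * ENNReal.ofReal (q θ) < ⊤) :
    ∃ s : ℝ≥0∞,
      IsLeast (OBB.avgCRB μ Θ q p '' OBB.H1 Θ q) s ∧
      s ≠ 0 ∧ s ≠ ⊤ ∧
      (∀ T : X → OBB.Param n, OBB.IsEstimator μ Θ p T → s ≤ OBB.bayesMSE μ Θ q p T) ∧
      ∃ b₀ ∈ OBB.H1 Θ q, OBB.avgCRB μ Θ q p b₀ = s ∧
        ∀ b ∈ OBB.H1 Θ q, OBB.avgCRB μ Θ q p b = s → b =ᵐ[OBB.priorMeasure Θ q] b₀ := by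
  obtain ⟨v, hv, hvtop, hvmin, hvuniq⟩ := OBB.exists_unique_jet_minimizer hq hp hq_inv
    (OBB.exists_jet_lintegral_ne_top hq hp hfin)
  have hH1 := OBB.fst_mem_H1 hq.isOpen hv
  have hval := OBB.avgCRB_fst (μ := μ) (p := p) hq hv
  refine ⟨_, ⟨⟨_, hH1, hval⟩, ?_⟩, OBB.lintegral_jetCRB_ne_zero hn hq hp hv, hvtop, ?_,
    _, hH1, hval, ?_⟩
  · rintro _ ⟨b, hb, rfl⟩
    rw [OBB.avgCRB_eq_lintegral hq]
    exact hvmin _ (OBB.jet_mem_jetSpace hb)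
  · intro T hT
    rcases eq_or_ne (OBB.bayesMSE μ Θ q p T) ⊤ with htop | htop
    · rw [htop]; exact le_top
    obtain ⟨u, hu, hle⟩ :=
      OBB.lintegral_jetCRB_le_bayesMSE hq hp hT (lt_top_iff_ne_top.2 htop)
    exact (hvmin u hu).trans hle
  · intro b hb hbs
    rw [OBB.avgCRB_eq_lintegral hq] at hbs
    exact (hvuniq _ (OBB.jet_mem_jetSpace hb) hbs).mono fun θ hθ => congrArg Prod.fst hθ
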